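/- A unimodal sequence of size $n\ge 1$ is a finite sequence $\lambda=(\lambda_1,\dots,\lambda_s)$ of positive integers with $\sum_j\lambda_j=n$ and $\lambda_1\le\dots\le\lambda_{k}\ge\lambda_{k+1}\ge\dots\ge\lambda_s$ for some $k$; the parts equal to $\max_j\lambda_j$ are its peaks. Let $\mathcal S(n)$ be the set of unimodal sequences of size $n$ and $s(n)=\#\mathcal S(n)$. The diagram of $\lambda$ consists of adjacent columns of width $1$ standing on the $x$-axis, the $j$-th of height $\lambda_j$, placed so that the upper left corner of the column of the left-most peak lies on the $y$-axis. Its top border (the top edges of the columns and the vertical segments joining them, including the outer sides of the first and last columns), rescaled by $1/\sqrt n$ in both directions, is the renormalized shape $\widetilde\varphi(\lambda)\subset\mathbb R^2$. Let $$f_s(x)=-\frac{\sqrt3}{\pi}\log\left(1-e^{-\frac{\pi}{\sqrt3}|x|}\right)\qquad(x\neq0),$$ and for $\epsilon>0$ let $N_\epsilon(f_s)$ be the set of points of the plane whose horizontal distance from the curve $y=f_s(x)$ is at most $\epsilon$, together with the open $\epsilon$-neighborhoods of the $x$-axis and of the $y$-axis. **Theorem.** (a) For every $\epsilon>0$, $$\lim_{n\to\infty}\frac{1}{s(n)}\,\#\left\{\lambda\in\mathcal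 S(n):\widetilde\varphi(\lambda)\subset N_\epsilon(f_s)\right\}=1.$$ (b) Each half of $f_s$ is Vershik's limit shape for partitions, $f_p(x)=-\frac{\sqrt6}{\pi}\log\left(1-e^{-\frac{\pi}{\sqrt6}x}\right)$ for $x>0$, scaled down so that the area beneath it is $\frac12$: $f_s(x)=\frac1{\sqrt2}f_p(\sqrt2\,|x|)$ for $x\ne0$, and $f_s$ is integrable with $\int_{-\infty}^0f_s(x)\,dx=\int_0^\infty f_s(x)\,dx=\frac12$. (c) The peaks of almost all unimodal sequences are $\omega(\sqrt n)$ in size: for every $t>0$, $$\lim_{n\to\infty}\frac{1}{s(n)}\,\#\left\{\lambda\in\mathcal S(n):\max_j\lambda_j\le t\sqrt n\right\}=0.$$ -/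

import Mathlib

open Filter Topology MeasureTheory

namespace UnimodalShape

/-- A sequence of positive integers with sum `n` (a `Composition n`) is unimodal if it is nonempty
and, for some index `k`, weakly increases up to `k` and weakly decreases from `k` on. -/
def IsUnimodal {n : ℕ} (c : Composition n) : Prop :=
  ∃ k : Fin c.length,
    MonotoneOn c.blocksFun (Set.Iic k) ∧ AntitoneOn c.blocksFun (Set.Ici k)

/-- The (finite) set of unimodal sequences of size `n`. -/
def unimodalSeqs (n : ℕ) : Set (Composition n) :=
  {c | IsUnimodal c}

/-- The number of unimodal sequences of size `n`. -/
noncomputable def numUnimodal (n : ℕ) : ℕ :=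
  (unimodalSeqs n).ncard

/-- `colHeight c j` is the height of the `j`-th column of the diagram, `j = 1, …, s`, where `s` is
the number of parts; it is `0` for `j = 0` and for `j > s`. -/
def colHeight {n : ℕ} (c : Composition n) (j : ℕ) : ℕ :=
  (0 :: c.blocks).getD j 0

/-- The size of the peaks, that is, the largest part. -/
def peak {n : ℕ} (c : Composition n) : ℕ :=
  Finset.univ.sup c.blocksFun

/-- The number of parts strictly to the left of the left-most peak. -/
def leftCount {n : ℕ} (c : Composition n) : ℕ :=
  c.blocks.idxOf (peak c)

/-- The shape of `c`: the top border of its diagram, from the `x`-axis to the `x`-axis. The diagram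
consists of columns of width one; column `j` has height `colHeight c j`, and the columns are placed
so that the left-most peak vertex (the upper left corner of the first column of maximal height) is
on the `y`-axis; thus column `j` lies over `[j - 1 - leftCount c, j - leftCount c]`. The border is
made of the top edges of the columns and of the vertical segments that join consecutive top edges,
including the outer sides of the first and of the last column. -/
def shape {n : ℕ} (c : Composition n) : Set (ℝ × ℝ) :=
  {p | ∃ j : ℕ, 1 ≤ j ∧ j ≤ c.length ∧
      (j : ℝ) - 1 - leftCount c ≤ p.1 ∧ p.1 ≤ (j : ℝ) - leftCount c ∧
      p.2 = colHeight c j} ∪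
  {p | ∃ j : ℕ, j ≤ c.length ∧
      p.1 = (j : ℝ) - leftCount c ∧
      p.2 ∈ Set.uIcc (colHeight c j : ℝ) (colHeight c (j + 1) : ℝ)}

/-- The renormalized shape: both axes are rescaled by `1 / √n`, so that the diagram has area 1. -/
noncomputable def renormShape {n : ℕ} (c : Composition n) : Set (ℝ × ℝ) :=
  (fun p : ℝ × ℝ => (p.1 / √(n : ℝ), p.2 / √(n : ℝ))) '' shape c

/-- For a function `f` with domain `D`: the points at horizontal distance at most `ε` from the graph
of `f`, together with the `ε`-neighbourhoods of the `x`-axis and of the `y`-axis. -/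
def curveNhd (ε : ℝ) (D : Set ℝ) (f : ℝ → ℝ) : Set (ℝ × ℝ) :=
  {p | ∃ x ∈ D, f x = p.2 ∧ |p.1 - x| ≤ ε} ∪ {p | |p.2| < ε} ∪ {p | |p.1| < ε}

/-- The limit shape of unimodal sequences; it is a function on `x ≠ 0`. -/
noncomputable def limitShape (x : ℝ) : ℝ :=
  -(√3 / Real.pi) * Real.log (1 - Real.exp (-(Real.pi / √3) * |x|))

/-- Vershik's limit shape of integer partitions; it is a function on `x > 0`. -/
noncomputable def vershikCurve (x : ℝ) : ℝ :=
  -(√6 / Real.pi) * Real.log (1 - Real.exp (-(Real.pi / √6) * x))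

end UnimodalShape

open UnimodalShape

/-!
The theorem is a large deviation statement on the scale `exp (const * √n)`, and it is proved with
generating functions and Chernoff bounds; write `rate = π / √3`.

A unimodal sequence is cut in front of its left-most peak. Read outwards, both sides are partitions,
and the sequence is determined by their multiplicities (`eq_of_count_eq`). Hence the weight `q ^ n`,
summed over unimodal sequences, is at most the square of Euler's product, and at
`q = exp (-rate / √n)` this gives at most `exp (2 * rate * √n)` sequences of size `n`. Conversely,
every pair of partitions gives a unimodal sequence, with a loss polynomial in `n` only
(`card_le_mul_numUnimodal`), and at a slightly smaller `q` the weight of all pairs is concentrated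
on sizes slightly below `n` (`sum_exp_multSize_le_numUnimodal`), so that there are at least
`exp ((2 * rate - o(1)) * √n)` sequences (`eventually_exp_le_numUnimodal`). Both bounds rest on
`-log ∏ (1 - exp (-τ * k)) ~ π² / (6 * τ)` as `τ → 0`.

If moreover every part of size at least `y * √n` on one side gets a weight `z`, then the product
changes by a factor of at most `exp ((momentRate y z + o(1)) * √n)`, by comparison with telescoping
sums of `log (1 - z * q ^ k)`. The derivative of `momentRate y` at `z = 1` is `limitShape y`, so
Chernoff's bound with `z` close to `1` shows that the sequences whose number of such parts is not
close to `limitShape y * √n` are fewer than all sequences by a factor exponential in `√n`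
(`tendsto_deviating`).

The column counts locate the border of the diagram horizontally (`mem_shape_left`,
`mem_shape_right`). Since the border is monotone on each side, finitely many heights suffice to keep
it near the curve (`renormShape_subset_curveNhd`). A peak of size at most `t * √n` would make the
count at height `2 * t * √n` vanish, which is a deviation too (`tendsto_peak_le`). The area under
the curve is the integral of the series of the logarithm, that is, `ζ(2)`.
-/

namespace UnimodalShape

/-! ### The limit shape -/

/-- The constant `π / √3`: almost all of the mass of the generating function of unimodal sequences
at `q = exp (-rate / √n)` sits at sizes close to `n`. -/
noncomputable def rate : ℝ := Real.pi / √3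

lemma rate_pos : 0 < rate := by unfold rate; positivity

lemma rate_sq : rate ^ 2 = Real.pi ^ 2 / 3 := by
  unfold rate; rw [div_pow, Real.sq_sqrt (by norm_num)]

lemma limitShape_eq (x : ℝ) :
    limitShape x = rate⁻¹ * -Real.log (1 - Real.exp (-(rate * |x|))) := by
  unfold limitShape rate; rw [inv_div]; ring_nf

lemma limitShape_neg (x : ℝ) : limitShape (-x) = limitShape x := by
  simp [limitShape_eq]

lemma exp_neg_mul_lt_one {a x : ℝ} (ha : 0 < a) (hx : 0 < x) : Real.exp (-(a * x)) < 1 :=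
  Real.exp_lt_one_iff.2 (neg_neg_of_pos (mul_pos ha hx))

lemma limitShape_pos {x : ℝ} (hx : 0 < x) : 0 < limitShape x := by
  rw [limitShape_eq, abs_of_pos hx]
  have h := exp_neg_mul_lt_one rate_pos hx
  have h' := Real.exp_pos (-(rate * x))
  exact mul_pos (inv_pos.2 rate_pos)
    (neg_pos.2 (Real.log_neg (by linarith) (by linarith)))

/-- The curve is symmetric in the diagonal: it is `exp (-rate * x) + exp (-rate * y) = 1`. -/
lemma limitShape_limitShape {x : ℝ} (hx : 0 < x) : limitShape (limitShape x) = x := by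
  have h := exp_neg_mul_lt_one rate_pos hx
  have hr := rate_pos
  rw [limitShape_eq (limitShape x), abs_of_pos (limitShape_pos hx), limitShape_eq, abs_of_pos hx,
    mul_inv_cancel_left₀ hr.ne', neg_neg, Real.exp_log (by linarith), sub_sub_cancel,
    Real.log_exp, neg_neg, inv_mul_cancel_left₀ hr.ne']

lemma limitShape_lt {x y : ℝ} (hx : 0 < x) (hxy : x < y) : limitShape y < limitShape x := by
  have hr := rate_pos
  have h := exp_neg_mul_lt_one hr hx
  rw [limitShape_eq, limitShape_eq, abs_of_pos hx, abs_of_pos (hx.trans hxy)]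
  have h2 : Real.exp (-(rate * y)) < Real.exp (-(rate * x)) :=
    Real.exp_lt_exp.2 (neg_lt_neg (mul_lt_mul_of_pos_left hxy hr))
  exact mul_lt_mul_of_pos_left (neg_lt_neg (Real.log_lt_log (by linarith) (by linarith)))
    (inv_pos.2 hr)

lemma limitShape_eq_vershikCurve (x : ℝ) : limitShape x = vershikCurve (√2 * |x|) / √2 := by
  have h6 : √6 = √2 * √3 := by
    rw [← Real.sqrt_mul (by norm_num)]; norm_num
  have h2 : √2 ≠ 0 := by positivity
  have h3 : √3 ≠ 0 := by positivity
  unfold limitShape vershikCurve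
  rw [h6]
  have e : -(Real.pi / (√2 * √3)) * (√2 * |x|) = -(Real.pi / √3) * |x| := by field_simp
  rw [e]
  field_simp

lemma hasSum_one_div_succ_sq :
    HasSum (fun j : ℕ => (1 : ℝ) / ((j + 1 : ℕ) : ℝ) ^ 2) (Real.pi ^ 2 / 6) := by
  have := (hasSum_nat_add_iff' (f := fun n : ℕ => (1 : ℝ) / (n : ℝ) ^ 2) 1).2 hasSum_zeta_two
  simpa using this

lemma integral_exp_term (j : ℕ) :
    IntegrableOn (fun x : ℝ => Real.exp (-(rate * x)) ^ (j + 1) / (j + 1 : ℝ)) (Set.Ioi 0) ∧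
    ∫ x in Set.Ioi (0 : ℝ), Real.exp (-(rate * x)) ^ (j + 1) / (j + 1 : ℝ) =
      rate⁻¹ * (1 / ((j + 1 : ℕ) : ℝ) ^ 2) := by
  have hb : 0 < rate * (j + 1 : ℝ) := mul_pos rate_pos (by positivity)
  have e : ∀ x : ℝ, Real.exp (-(rate * x)) ^ (j + 1) = Real.exp (-(rate * (j + 1 : ℝ)) * x) := by
    intro x; rw [← Real.exp_nat_mul]; push_cast; ring_nf
  simp only [e]
  refine ⟨(integrableOn_exp_mul_Ioi (by linarith) 0).div_const _, ?_⟩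
  rw [integral_div, integral_exp_mul_Ioi (by linarith)]
  have := rate_pos.ne'
  simp
  field_simp

lemma limitShape_integral_Ioi :
    IntegrableOn limitShape (Set.Ioi 0) ∧ ∫ x in Set.Ioi (0 : ℝ), limitShape x = 1 / 2 := by
  have hr := rate_pos
  have hnorm : ∀ j : ℕ, ∫ x in Set.Ioi (0 : ℝ), ‖Real.exp (-(rate * x)) ^ (j + 1) / (j + 1 : ℝ)‖ =
      rate⁻¹ * (1 / ((j + 1 : ℕ) : ℝ) ^ 2) := by
    intro j
    rw [← (integral_exp_term j).2]
    congr 1; ext x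
    exact Real.norm_of_nonneg (by positivity)
  have hsum : Summable fun j : ℕ =>
      ∫ x in Set.Ioi (0 : ℝ), ‖Real.exp (-(rate * x)) ^ (j + 1) / (j + 1 : ℝ)‖ := by
    simp only [hnorm]; exact hasSum_one_div_succ_sq.summable.mul_left _
  have hlog : ∀ x ∈ Set.Ioi (0 : ℝ),
      HasSum (fun j : ℕ => Real.exp (-(rate * x)) ^ (j + 1) / (j + 1 : ℝ))
        (-Real.log (1 - Real.exp (-(rate * |x|)))) := by
    intro x hx
    rw [abs_of_pos hx]
    apply Real.hasSum_pow_div_log_of_abs_lt_one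
    rw [abs_of_pos (Real.exp_pos _)]
    exact exp_neg_mul_lt_one hr hx
  have key := hasSum_integral_of_summable_integral_norm
    (μ := volume.restrict (Set.Ioi (0 : ℝ))) (fun j => (integral_exp_term j).1) hsum
  have heq : ∫ x in Set.Ioi (0 : ℝ), ∑' j : ℕ, Real.exp (-(rate * x)) ^ (j + 1) / (j + 1 : ℝ)
      = ∫ x in Set.Ioi (0 : ℝ), -Real.log (1 - Real.exp (-(rate * |x|))) :=
    setIntegral_congr_fun measurableSet_Ioi fun x hx => (hlog x hx).tsum_eq
  have hval : ∫ x in Set.Ioi (0 : ℝ), -Real.log (1 - Real.exp (-(rate * |x|)))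
      = rate⁻¹ * (Real.pi ^ 2 / 6) := by
    rw [← heq]
    refine key.unique ?_
    simp only [fun j => (integral_exp_term j).2]
    exact hasSum_one_div_succ_sq.mul_left _
  have hfun : limitShape = fun x => rate⁻¹ * -Real.log (1 - Real.exp (-(rate * |x|))) :=
    funext limitShape_eq
  have hint : ∫ x in Set.Ioi (0 : ℝ), limitShape x = 1 / 2 := by
    rw [hfun, integral_const_mul, hval]
    have h := rate_sq
    have : Real.pi ^ 2 / 6 = rate ^ 2 / 2 := by rw [h]; ring
    rw [this]; field_simp
  refine ⟨?_, hint⟩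
  -- a function that is not integrable has integral `0` by convention
  by_contra hni
  rw [integral_undef hni] at hint
  norm_num at hint

lemma limitShape_integral_Iio :
    IntegrableOn limitShape (Set.Iio 0) ∧ ∫ x in Set.Iio (0 : ℝ), limitShape x = 1 / 2 := by
  have hint : ∫ x in Set.Iio (0 : ℝ), limitShape x = 1 / 2 := by
    rw [← integral_Iic_eq_integral_Iio]
    have h := integral_comp_neg_Ioi (0 : ℝ) limitShape
    rw [neg_zero] at h
    rw [← h, ← limitShape_integral_Ioi.2]
    simp only [limitShape_neg]
  refine ⟨?_, hint⟩
  by_contra hni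
  rw [integral_undef hni] at hint
  norm_num at hint

/-! ### The partition generating function near `q = 1` -/

lemma inv_exp_sub_one_le {u : ℝ} (hu : 0 < u) : (Real.exp u - 1)⁻¹ ≤ u⁻¹ :=
  inv_anti₀ hu (by linarith [Real.add_one_le_exp u])

lemma exp_neg_div_one_sub {u : ℝ} (hu : 0 < u) :
    Real.exp (-u) / (1 - Real.exp (-u)) = (Real.exp u - 1)⁻¹ := by
  have h1 : 1 < Real.exp u := Real.one_lt_exp_iff.2 hu
  rw [Real.exp_neg]
  have : Real.exp u - 1 ≠ 0 := by linarith
  field_simp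

/-- The partition generating function at `exp (-τ)` is at most `exp (π² / (6 τ))`. -/
lemma prod_inv_one_sub_le {τ : ℝ} (hτ : 0 < τ) (n : ℕ) :
    ∏ k ∈ Finset.range n, (1 - Real.exp (-τ) ^ (k + 1))⁻¹ ≤ Real.exp (Real.pi ^ 2 / 6 / τ) := by
  have hq0 : 0 < Real.exp (-τ) := Real.exp_pos _
  have hq1 : Real.exp (-τ) < 1 := Real.exp_lt_one_iff.2 (by linarith)
  have hpow : ∀ k : ℕ, Real.exp (-τ) ^ (k + 1) < 1 := fun k =>
    pow_lt_one₀ hq0.le hq1 (Nat.succ_ne_zero k)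
  have hp : ∀ k : ℕ, 0 < (1 - Real.exp (-τ) ^ (k + 1))⁻¹ := fun k =>
    inv_pos.2 (by linarith [hpow k])
  rw [← Real.log_le_iff_le_exp (Finset.prod_pos fun k _ => hp k),
    Real.log_prod fun k _ => (hp k).ne']
  simp only [Real.log_inv]
  have h1 : HasSum (fun j : ℕ => ∑ k ∈ Finset.range n,
      (Real.exp (-τ) ^ (k + 1)) ^ (j + 1) / (j + 1 : ℝ))
      (∑ k ∈ Finset.range n, -Real.log (1 - Real.exp (-τ) ^ (k + 1))) :=
    hasSum_sum fun k _ => Real.hasSum_pow_div_log_of_abs_lt_one (by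
      rw [abs_of_pos (pow_pos hq0 _)]; exact hpow k)
  have hz : HasSum (fun j : ℕ => (1 : ℝ) / ((j + 1 : ℕ) : ℝ) ^ 2 / τ) (Real.pi ^ 2 / 6 / τ) :=
    hasSum_one_div_succ_sq.div_const τ
  refine hasSum_le (fun j => ?_) h1 hz
  have hu : 0 < τ * (j + 1 : ℝ) := by positivity
  have hx : Real.exp (-τ) ^ (j + 1) = Real.exp (-(τ * (j + 1 : ℝ))) := by
    rw [← Real.exp_nat_mul]; push_cast; ring_nf
  have hgeom : ∑ k ∈ Finset.range n, (Real.exp (-τ) ^ (j + 1)) ^ (k + 1)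
      ≤ (τ * (j + 1 : ℝ))⁻¹ := by
    refine le_trans ?_ (inv_exp_sub_one_le hu)
    rw [← exp_neg_div_one_sub hu, ← hx]
    simp only [pow_succ' (Real.exp (-τ) ^ (j + 1)), ← Finset.mul_sum]
    rw [div_eq_mul_inv]
    refine mul_le_mul_of_nonneg_left ?_ (pow_pos hq0 _).le
    have hs := hasSum_geometric_of_lt_one (pow_pos hq0 (j + 1)).le (hpow j)
    exact sum_le_hasSum _ (fun i _ => by positivity) hs
  calc ∑ k ∈ Finset.range n, (Real.exp (-τ) ^ (k + 1)) ^ (j + 1) / (j + 1 : ℝ)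
      = (∑ k ∈ Finset.range n, (Real.exp (-τ) ^ (j + 1)) ^ (k + 1)) / (j + 1 : ℝ) := by
        rw [Finset.sum_div]
        refine Finset.sum_congr rfl fun k _ => ?_
        rw [← pow_mul, ← pow_mul, mul_comm]
    _ ≤ (τ * (j + 1 : ℝ))⁻¹ / (j + 1 : ℝ) := by gcongr
    _ = 1 / ((j + 1 : ℕ) : ℝ) ^ 2 / τ := by push_cast; field_simp

/-- The bound of `prod_inv_one_sub_le` is sharp to leading order as `τ → 0`. -/
lemma eventually_exp_lt_prod_inv_one_sub {η : ℝ} (hη : 0 < η) :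
    ∀ᶠ τ in 𝓝[>] (0 : ℝ), ∃ M : ℕ,
      Real.exp ((Real.pi ^ 2 / 6 - η) / τ) <
        ∏ k ∈ Finset.range M, (1 - Real.exp (-τ) ^ (k + 1))⁻¹ := by
  obtain ⟨J, hJ⟩ := (hasSum_one_div_succ_sq.tendsto_sum_nat.eventually_const_lt
    (show Real.pi ^ 2 / 6 - η < Real.pi ^ 2 / 6 by linarith)).exists
  -- `τ / (exp (τ (j + 1)) - 1) → 1 / (j + 1)`
  have hlim : ∀ j : ℕ, Tendsto (fun τ : ℝ => τ * (Real.exp (τ * (j + 1 : ℝ)) - 1)⁻¹)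
      (𝓝[>] 0) (𝓝 (j + 1 : ℝ)⁻¹) := by
    intro j
    have hd : HasDerivAt (fun τ : ℝ => Real.exp (τ * (j + 1 : ℝ))) (j + 1 : ℝ) 0 := by
      have := ((hasDerivAt_id (0 : ℝ)).mul_const (j + 1 : ℝ)).exp
      simpa using this
    have := (hd.tendsto_slope_zero_right).inv₀ (by positivity)
    refine this.congr fun τ => ?_
    simp [mul_comm]
  have hlimsum : Tendsto (fun τ : ℝ => ∑ j ∈ Finset.range J,
      τ * (Real.exp (τ * (j + 1 : ℝ)) - 1)⁻¹ / (j + 1 : ℝ)) (𝓝[>] 0)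
      (𝓝 (∑ j ∈ Finset.range J, (1 : ℝ) / ((j + 1 : ℕ) : ℝ) ^ 2)) := by
    refine tendsto_finsetSum _ fun j _ => ?_
    have := (hlim j).div_const (j + 1 : ℝ)
    convert this using 2
    push_cast; field_simp
  filter_upwards [hlimsum.eventually_const_lt hJ, self_mem_nhdsWithin] with τ hτJ hτ
  have hτ : 0 < τ := hτ
  have hq0 : 0 < Real.exp (-τ) := Real.exp_pos _
  have hq1 : Real.exp (-τ) < 1 := Real.exp_lt_one_iff.2 (by linarith)
  have hpow : ∀ k : ℕ, Real.exp (-τ) ^ (k + 1) < 1 := fun k =>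
    pow_lt_one₀ hq0.le hq1 (Nat.succ_ne_zero k)
  have hp : ∀ k : ℕ, 0 < (1 - Real.exp (-τ) ^ (k + 1))⁻¹ := fun k =>
    inv_pos.2 (by linarith [hpow k])
  have hM : Tendsto (fun M : ℕ => ∑ j ∈ Finset.range J,
      (∑ k ∈ Finset.range M, (Real.exp (-τ) ^ (j + 1)) ^ (k + 1)) / (j + 1 : ℝ)) atTop
      (𝓝 (∑ j ∈ Finset.range J, (Real.exp (τ * (j + 1 : ℝ)) - 1)⁻¹ / (j + 1 : ℝ))) := by
    refine tendsto_finsetSum _ fun j _ => Tendsto.div_const ?_ _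
    have hu : 0 < τ * (j + 1 : ℝ) := by positivity
    have hx : Real.exp (-τ) ^ (j + 1) = Real.exp (-(τ * (j + 1 : ℝ))) := by
      rw [← Real.exp_nat_mul]; push_cast; ring_nf
    rw [← exp_neg_div_one_sub hu, ← hx]
    have hs := (hasSum_geometric_of_lt_one (pow_pos hq0 (j + 1)).le (hpow j)).mul_left
      (Real.exp (-τ) ^ (j + 1))
    simp only [← pow_succ'] at hs
    exact hs.tendsto_sum_nat
  have hlt : (Real.pi ^ 2 / 6 - η) / τ <
      ∑ j ∈ Finset.range J, (Real.exp (τ * (j + 1 : ℝ)) - 1)⁻¹ / (j + 1 : ℝ) := by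
    rw [div_lt_iff₀ hτ, Finset.sum_mul]
    refine hτJ.trans_le (le_of_eq (Finset.sum_congr rfl fun j _ => ?_))
    ring
  obtain ⟨M, hM⟩ := (hM.eventually_const_lt hlt).exists
  refine ⟨M, ?_⟩
  rw [← Real.lt_log_iff_exp_lt (Finset.prod_pos fun k _ => hp k),
    Real.log_prod fun k _ => (hp k).ne']
  refine hM.trans_le ?_
  simp only [Real.log_inv, Finset.sum_div]
  rw [Finset.sum_comm]
  refine Finset.sum_le_sum fun k _ => ?_
  have hs := Real.hasSum_pow_div_log_of_abs_lt_one (x := Real.exp (-τ) ^ (k + 1)) (by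
      rw [abs_of_pos (pow_pos hq0 _)]; exact hpow k)
  refine le_trans (le_of_eq (Finset.sum_congr rfl fun j _ => ?_))
    (sum_le_hasSum (Finset.range J) (fun j _ => by positivity) hs)
  rw [← pow_mul, ← pow_mul, mul_comm]

/-! ### The two sides of a unimodal sequence -/

/-- The two sides of a sequence, each read from the peak outwards: side `false` consists of the
parts strictly to the left of the left-most peak, side `true` of the others. For a unimodal sequence
both are weakly decreasing. -/
def sidePart {n : ℕ} (c : Composition n) : Bool → List ℕ
  | false => (c.blocks.take (leftCount c)).reverse
  | true => c.blocks.drop (leftCount c)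

/-- The number of parts of size at least `Y` on side `b`. -/
noncomputable def sideCount {n : ℕ} (c : Composition n) (b : Bool) (Y : ℝ) : ℕ :=
  (sidePart c b).countP (fun a : ℕ => decide (Y ≤ (a : ℝ)))

/-- The number of parts of size more than `Y` on side `b`. -/
noncomputable def sideCountGt {n : ℕ} (c : Composition n) (b : Bool) (Y : ℝ) : ℕ :=
  (sidePart c b).countP (fun a : ℕ => decide (Y < (a : ℝ)))

section Sides

variable {n : ℕ} {c : Composition n}

lemma blocksFun_le_peak (i : Fin c.length) : c.blocksFun i ≤ peak c :=
  Finset.le_sup (f := c.blocksFun) (Finset.mem_univ i)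

lemma le_peak {a : ℕ} (ha : a ∈ c.blocks) : a ≤ peak c := by
  obtain ⟨i, hi, rfl⟩ := List.getElem_of_mem ha
  exact blocksFun_le_peak ⟨i, hi⟩

lemma mem_blocks_of_mem_sidePart {b : Bool} {a : ℕ} (ha : a ∈ sidePart c b) : a ∈ c.blocks := by
  cases b
  · exact List.mem_of_mem_take (List.mem_reverse.1 ha)
  · exact List.mem_of_mem_drop ha

lemma sidePart_append : (sidePart c false).reverse ++ sidePart c true = c.blocks := by
  simp [sidePart]

lemma sidePart_sum_add : (sidePart c false).sum + (sidePart c true).sum = n := by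
  have h := congrArg List.sum (sidePart_append (c := c))
  rwa [List.sum_append, List.sum_reverse, c.blocks_sum] at h

lemma sidePart_pairwise (hc : IsUnimodal c) (b : Bool) : (sidePart c b).Pairwise (· ≥ ·) := by
  obtain ⟨k, hmono, hanti⟩ := hc
  have hget : ∀ (i : ℕ) (hi : i < c.blocks.length), c.blocks[i] = c.blocksFun ⟨i, hi⟩ :=
    fun i hi => rfl
  have hk : c.blocksFun k = peak c := by
    refine le_antisymm (blocksFun_le_peak k) (Finset.sup_le fun i _ => ?_)
    rcases le_total i k with h | h
    · exact hmono h (le_refl k) h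
    · exact hanti (le_refl k) h h
  have hmem : peak c ∈ c.blocks := hk ▸ c.blocksFun_mem_blocks k
  have hL : leftCount c < c.blocks.length := List.idxOf_lt_length_of_mem hmem
  have hLp : c.blocksFun ⟨leftCount c, hL⟩ = peak c := List.getElem_idxOf hL
  have hLk : (⟨leftCount c, hL⟩ : Fin c.length) ≤ k := by
    by_contra hlt
    have hlt : (k : ℕ) < leftCount c := not_le.1 hlt
    have := List.not_of_lt_findIdx (p := fun x => x == peak c) (xs := c.blocks) (i := k) hlt
    simp at this
    exact this hk
  cases b
  · rw [sidePart, List.pairwise_reverse, List.pairwise_iff_getElem]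
    intro i j hi hj hij
    rw [List.length_take] at hi hj
    rw [List.getElem_take, List.getElem_take, hget, hget]
    exact hmono (show _ ≤ k from le_trans (Fin.mk_le_mk.2 (by omega)) hLk)
      (show _ ≤ k from le_trans (Fin.mk_le_mk.2 (by omega)) hLk) (Fin.mk_le_mk.2 hij.le)
  · rw [sidePart, List.pairwise_iff_getElem]
    intro i j hi hj hij
    rw [List.length_drop] at hi hj
    rw [List.getElem_drop, List.getElem_drop, hget, hget]
    have hi' : leftCount c + i < c.length := show _ < c.blocks.length by omega
    rcases le_total (⟨leftCount c + i, hi'⟩ : Fin c.length) k with h | h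
    · -- between the left-most peak and the index `k` all parts are peaks
      have : c.blocksFun ⟨leftCount c, hL⟩ ≤ c.blocksFun ⟨leftCount c + i, hi'⟩ :=
        hmono hLk h (Fin.mk_le_mk.2 (by omega))
      exact le_trans (blocksFun_le_peak _) (hLp ▸ this)
    · exact hanti h (h.trans (Fin.mk_le_mk.2 (by omega))) (Fin.mk_le_mk.2 (by omega))

/-- A unimodal sequence is determined by the multiplicities of the parts on its two sides. -/
lemma eq_of_count_eq {c' : Composition n} (hc : IsUnimodal c) (hc' : IsUnimodal c')
    (h : ∀ b, ∀ k < n, (sidePart c b).count (k + 1) = (sidePart c' b).count (k + 1)) :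
    c = c' := by
  have hs : ∀ b, sidePart c b = sidePart c' b := by
    intro b
    refine List.Perm.eq_of_pairwise (le := fun a b : ℕ => a ≥ b)
      (fun a b _ _ h1 h2 => le_antisymm h2 h1) (sidePart_pairwise hc b) (sidePart_pairwise hc' b) ?_
    rw [List.perm_iff_count]
    intro a
    by_cases ha : 1 ≤ a ∧ a ≤ n
    · obtain ⟨k, rfl⟩ := Nat.exists_eq_add_of_le' ha.1
      exact h b k (by omega)
    · have key : ∀ d : Composition n, a ∉ sidePart d b := fun d hd =>
        ha ⟨d.one_le_blocks (mem_blocks_of_mem_sidePart hd),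
          d.blocks_le (mem_blocks_of_mem_sidePart hd)⟩
      rw [List.count_eq_zero_of_not_mem (key c), List.count_eq_zero_of_not_mem (key c')]
  ext1
  rw [← sidePart_append (c := c), ← sidePart_append (c := c'), hs, hs]

/-! ### Weighted counting of unimodal sequences -/

/-- Euler's product bounds the weight of any finite set of multiplicity functions. -/
lemma sum_prod_pow_le {ι : Type*} [Fintype ι] [DecidableEq ι] (x : ι → ℝ) (hx0 : ∀ i, 0 ≤ x i)
    (hx1 : ∀ i, x i < 1) (T : Finset (ι → ℕ)) :
    ∑ m ∈ T, ∏ i, x i ^ m i ≤ ∏ i, (1 - x i)⁻¹ := by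
  let B := (T.sup fun m => Finset.univ.sup m) + 1
  have hsub : T ⊆ Fintype.piFinset fun _ : ι => Finset.range B := by
    intro m hm
    rw [Fintype.mem_piFinset]
    intro i
    rw [Finset.mem_range, Nat.lt_succ_iff]
    exact (Finset.le_sup (f := m) (Finset.mem_univ i)).trans
      (Finset.le_sup (f := fun m : ι → ℕ => Finset.univ.sup m) hm)
  calc ∑ m ∈ T, ∏ i, x i ^ m i
      ≤ ∑ m ∈ Fintype.piFinset fun _ : ι => Finset.range B, ∏ i, x i ^ m i :=
        Finset.sum_le_sum_of_subset_of_nonneg hsub fun m _ _ =>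
          Finset.prod_nonneg fun i _ => pow_nonneg (hx0 i) _
    _ = ∏ i, ∑ j ∈ Finset.range B, x i ^ j :=
        (Finset.prod_univ_sum (fun _ => Finset.range B) fun i j => x i ^ j).symm
    _ ≤ ∏ i, (1 - x i)⁻¹ :=
        Finset.prod_le_prod (fun i _ => Finset.sum_nonneg fun j _ => pow_nonneg (hx0 i) _)
          fun i _ => sum_le_hasSum _ (fun j _ => pow_nonneg (hx0 i) _)
            (hasSum_geometric_of_lt_one (hx0 i) (hx1 i))

lemma prod_map_sidePart (x : ℕ → ℝ) (b : Bool) :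
    ((sidePart c b).map x).prod =
      ∏ k : Fin n, x (k + 1) ^ (sidePart c b).count ((k : ℕ) + 1) := by
  rw [Finset.prod_list_map_count,
    Fin.prod_univ_eq_prod_range (fun k => x (k + 1) ^ (sidePart c b).count (k + 1)) n,
    Finset.prod_subset (s₁ := (sidePart c b).toFinset)
      (s₂ := (Finset.range n).image (· + 1)) (f := fun a => x a ^ (sidePart c b).count a)]
  · rw [Finset.prod_image fun a _ b _ h => by simpa using h]
  · intro a ha
    have ha := mem_blocks_of_mem_sidePart (List.mem_toFinset.1 ha)
    have h1 := c.one_le_blocks ha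
    have h2 := c.blocks_le ha
    exact Finset.mem_image.2 ⟨a - 1, Finset.mem_range.2 (by omega), by omega⟩
  · intro a _ ha
    rw [List.mem_toFinset] at ha
    simp [List.count_eq_zero_of_not_mem ha]

/-- The total weight of a set of unimodal sequences is at most a product of two Euler products, one
for each side. -/
lemma sum_weight_le (x : Bool → ℕ → ℝ) (hx0 : ∀ b k, 0 ≤ x b k)
    (hx1 : ∀ b k, x b (k + 1) < 1) (T : Finset (Composition n)) (hT : ∀ c ∈ T, IsUnimodal c) :
    ∑ c ∈ T, ∏ b, ((sidePart c b).map (x b)).prod ≤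
      ∏ b, ∏ k ∈ Finset.range n, (1 - x b (k + 1))⁻¹ := by
  let Φ : Composition n → (Bool × Fin n → ℕ) := fun c i => (sidePart c i.1).count ((i.2 : ℕ) + 1)
  have hΦ : Set.InjOn Φ T := fun c hc c' hc' h => eq_of_count_eq (hT c hc) (hT c' hc')
    fun b k hk => congrFun h (b, ⟨k, hk⟩)
  have key := sum_prod_pow_le (fun i : Bool × Fin n => x i.1 (i.2 + 1)) (fun i => hx0 _ _)
    (fun i => hx1 _ _) (T.image Φ)
  rw [Finset.sum_image hΦ] at key
  simp only [Fintype.prod_prod_type] at key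
  refine le_trans (le_of_eq ?_) (key.trans (le_of_eq ?_))
  · simp only [prod_map_sidePart, Φ]
  · refine Finset.prod_congr rfl fun b _ => ?_
    exact Fin.prod_univ_eq_prod_range (fun k => (1 - x b (k + 1))⁻¹) n

lemma prod_map_pow_mul_ite (q z : ℝ) (p : ℕ → Prop) [DecidablePred p] (l : List ℕ) :
    (l.map fun k => q ^ k * if p k then z else 1).prod =
      q ^ l.sum * z ^ l.countP (fun a => decide (p a)) := by
  induction l with
  | nil => simp
  | cons a l ih =>
    rw [List.map_cons, List.prod_cons, ih, List.sum_cons, List.countP_cons, pow_add, pow_add]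
    by_cases h : p a <;> simp [h] <;> ring

/-- Weighting every unit of size by `q` and every part of size at least `Y` on side `b` by `z`. -/
lemma sum_pow_sideCount_le {q z Y : ℝ} (hq0 : 0 < q) (hq1 : q < 1) (hz : 0 < z) (b : Bool)
    (hzq : ∀ k : ℕ, Y ≤ k → z * q ^ k < 1)
    (T : Finset (Composition n)) (hT : ∀ c ∈ T, IsUnimodal c) :
    q ^ n * ∑ c ∈ T, z ^ sideCount c b Y ≤
      (∏ k ∈ Finset.range n, (1 - q ^ (k + 1))⁻¹) ^ 2 *
        ∏ k ∈ (Finset.range n).filter (fun k : ℕ => Y ≤ ((k + 1 : ℕ) : ℝ)),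
          ((1 - q ^ (k + 1)) / (1 - z * q ^ (k + 1))) := by
  classical
  have hpow : ∀ k : ℕ, q ^ (k + 1) < 1 := fun k => pow_lt_one₀ hq0.le hq1 (Nat.succ_ne_zero k)
  let x : Bool → ℕ → ℝ := fun b' k => q ^ k * if b' = b ∧ Y ≤ (k : ℝ) then z else 1
  have key := sum_weight_le x
    (fun b' k => mul_nonneg (pow_nonneg hq0.le _) (by split_ifs <;> linarith))
    (fun b' k => by
      by_cases h : b' = b ∧ Y ≤ ((k + 1 : ℕ) : ℝ)
      · simp only [x, if_pos h]; rw [mul_comm]; exact hzq _ h.2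
      · simp only [x, if_neg h, mul_one]; exact hpow k) T hT
  refine le_trans (le_of_eq ?_) (key.trans (le_of_eq ?_))
  · rw [Finset.mul_sum]
    refine Finset.sum_congr rfl fun c _ => ?_
    simp only [x, prod_map_pow_mul_ite, Fintype.prod_bool]
    have hn := sidePart_sum_add (c := c)
    cases b <;> simp [sideCount, ← hn, pow_add] <;> ring
  · have hb : ∏ k ∈ Finset.range n, (1 - x b (k + 1))⁻¹ =
        (∏ k ∈ Finset.range n, (1 - q ^ (k + 1))⁻¹) *
        ∏ k ∈ (Finset.range n).filter (fun k : ℕ => Y ≤ ((k + 1 : ℕ) : ℝ)),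
          ((1 - q ^ (k + 1)) / (1 - z * q ^ (k + 1))) := by
      rw [Finset.prod_filter, ← Finset.prod_mul_distrib]
      refine Finset.prod_congr rfl fun k _ => ?_
      have := hpow k
      have h0 : 1 - q ^ (k + 1) ≠ 0 := by linarith
      by_cases h : Y ≤ ((k + 1 : ℕ) : ℝ)
      · simp only [x, h, and_self, if_true]
        rw [div_eq_mul_inv, inv_mul_cancel_left₀ h0, mul_comm z]
      · simp only [x, h, and_false, if_false, mul_one]
    have hb' : ∏ k ∈ Finset.range n, (1 - x (!b) (k + 1))⁻¹ =
        ∏ k ∈ Finset.range n, (1 - q ^ (k + 1))⁻¹ := by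
      refine Finset.prod_congr rfl fun k _ => ?_
      simp [x]
    have : ∏ b', ∏ k ∈ Finset.range n, (1 - x b' (k + 1))⁻¹ =
        (∏ k ∈ Finset.range n, (1 - x b (k + 1))⁻¹) *
          ∏ k ∈ Finset.range n, (1 - x (!b) (k + 1))⁻¹ := by
      rw [Fintype.prod_bool]; cases b <;> simp [mul_comm]
    rw [this, hb, hb']
    ring

end Sides

/-! ### Points of the shape and column counts -/

section Shape

variable {n : ℕ} {c : Composition n}

lemma add_one_le_countP {D : List ℕ} (hD : D.Pairwise (· ≥ ·)) {i : ℕ} (hi : i < D.length)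
    {Y : ℝ} (hY : Y ≤ (D.getD i 0 : ℕ)) : i + 1 ≤ D.countP fun a : ℕ => decide (Y ≤ (a : ℝ)) := by
  have hall : (D.take (i + 1)).countP (fun a : ℕ => decide (Y ≤ (a : ℝ))) =
      (D.take (i + 1)).length := by
    rw [List.countP_eq_length]
    intro a ha
    obtain ⟨j, hj, rfl⟩ := List.getElem_of_mem ha
    rw [List.length_take] at hj
    rw [List.getElem_take, decide_eq_true_eq]
    rw [List.getD_eq_getElem _ _ hi] at hY
    refine hY.trans (Nat.cast_le.2 ?_)
    rcases (show j ≤ i by omega).eq_or_lt with rfl | h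
    · exact le_rfl
    · exact (List.pairwise_iff_getElem.1 hD) j i (by omega) hi h
  have h := (List.take_sublist (i + 1) D).countP_le (p := fun a : ℕ => decide (Y ≤ (a : ℝ)))
  rw [hall, List.length_take] at h
  omega

lemma countP_lt_le {D : List ℕ} (hD : D.Pairwise (· ≥ ·)) {i : ℕ}
    {Y : ℝ} (hY : (D.getD i 0 : ℕ) ≤ Y) : (D.countP fun a : ℕ => decide (Y < (a : ℝ))) ≤ i := by
  have hnone : (D.drop i).countP (fun a : ℕ => decide (Y < (a : ℝ))) = 0 := by
    rw [List.countP_eq_zero]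
    intro a ha
    obtain ⟨j, hj, rfl⟩ := List.getElem_of_mem ha
    rw [List.length_drop] at hj
    rw [List.getElem_drop, decide_eq_true_eq, not_lt]
    rw [List.getD_eq_getElem _ _ (by omega)] at hY
    refine le_trans (Nat.cast_le.2 ?_) hY
    rcases (show i ≤ i + j by omega).eq_or_lt with h | h
    · simp [← h]
    · exact (List.pairwise_iff_getElem.1 hD) i (i + j) (by omega) (by omega) h
  rw [← List.take_append_drop i D, List.countP_append, hnone, add_zero]
  exact List.countP_le_length.trans (by rw [List.length_take]; omega)

lemma getD_succ_le {D : List ℕ} (hD : D.Pairwise (· ≥ ·)) (i : ℕ) :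
    D.getD (i + 1) 0 ≤ D.getD i 0 := by
  by_cases h : i + 1 < D.length
  · rw [List.getD_eq_getElem _ _ h, List.getD_eq_getElem _ _ (by omega)]
    exact (List.pairwise_iff_getElem.1 hD) i (i + 1) (by omega) h (by omega)
  · rw [List.getD_eq_default _ _ (by omega)]; exact Nat.zero_le _

/-- The columns to the right of the `y`-axis, counted from it, are side `true`. -/
lemma colHeight_right (i : ℕ) :
    colHeight c (leftCount c + i + 1) = (sidePart c true).getD i 0 := by
  simp [colHeight, sidePart, List.getD_eq_getElem?_getD, List.getElem?_drop]

lemma leftCount_le : leftCount c ≤ c.blocks.length := List.idxOf_le_length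

/-- The columns to the left of the `y`-axis, counted from it, are side `false`. For
`i ≥ leftCount c` both sides of the equation vanish, since the subtraction is truncated and column
`0` has height `0`. -/
lemma colHeight_left (i : ℕ) :
    colHeight c (leftCount c - i) = (sidePart c false).getD i 0 := by
  have hL := leftCount_le (c := c)
  rcases lt_or_ge i (leftCount c) with h | h
  · have hlen : i < (sidePart c false).length := by simp [sidePart]; omega
    rw [List.getD_eq_getElem _ _ hlen]
    simp only [sidePart, List.getElem_reverse, List.getElem_take, List.length_take]
    obtain ⟨m, hm⟩ := Nat.exists_eq_add_of_lt h
    have e1 : leftCount c - i = m + 1 := by omega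
    have e2 : min (leftCount c) c.blocks.length - 1 - i = m := by omega
    simp only [e1, e2, colHeight, List.getD_cons_succ]
    rw [List.getD_eq_getElem]
  · have hlen : (sidePart c false).length ≤ i := by simp [sidePart]; omega
    rw [List.getD_eq_default _ _ hlen, Nat.sub_eq_zero_of_le h]
    simp [colHeight]

/-- A point of the border at height `Y` to the right of the `y`-axis lies between the numbers of
parts `> Y` and `≥ Y` on the right side. -/
lemma mem_shape_right (hc : IsUnimodal c) {p : ℝ × ℝ} (hp : p ∈ shape c) (h0 : 0 < p.1) :
    (sideCountGt c true p.2 : ℝ) ≤ p.1 ∧ p.1 ≤ sideCount c true p.2 := by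
  have hD := sidePart_pairwise hc true
  have hlen : (sidePart c true).length = c.length - leftCount c := by
    simp [sidePart, Composition.blocks_length]
  rcases hp with ⟨j, hj1, hj2, hx1, hx2, hy⟩ | ⟨j, hj, hx, hy⟩
  · have hjL : leftCount c < j := by
      have : (leftCount c : ℝ) < j := by linarith
      exact_mod_cast this
    obtain ⟨i, rfl⟩ := Nat.exists_eq_add_of_lt hjL
    rw [colHeight_right] at hy
    push_cast at hx1 hx2
    have hA : i + 1 ≤ sideCount c true p.2 :=
      add_one_le_countP hD (by omega) hy.le
    have hB : sideCountGt c true p.2 ≤ i := countP_lt_le hD hy.ge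
    have hA' : (i + 1 : ℝ) ≤ sideCount c true p.2 := by exact_mod_cast hA
    have hB' : (sideCountGt c true p.2 : ℝ) ≤ i := by exact_mod_cast hB
    constructor <;> linarith
  · have hjL : leftCount c < j := by
      have : (leftCount c : ℝ) < j := by linarith
      exact_mod_cast this
    obtain ⟨i, rfl⟩ := Nat.exists_eq_add_of_lt hjL
    rw [show leftCount c + i + 1 + 1 = leftCount c + (i + 1) + 1 by ring, colHeight_right,
      colHeight_right, Set.uIcc_of_ge (Nat.cast_le.2 (getD_succ_le hD i))] at hy
    push_cast at hx
    have hA : i + 1 ≤ sideCount c true p.2 :=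
      add_one_le_countP hD (by omega) hy.2
    have hB : sideCountGt c true p.2 ≤ i + 1 := countP_lt_le hD hy.1
    have hA' : (i + 1 : ℝ) ≤ sideCount c true p.2 := by exact_mod_cast hA
    have hB' : (sideCountGt c true p.2 : ℝ) ≤ i + 1 := by exact_mod_cast hB
    constructor <;> linarith

lemma mem_shape_left (hc : IsUnimodal c) {p : ℝ × ℝ} (hp : p ∈ shape c) (h0 : p.1 < 0) :
    (sideCountGt c false p.2 : ℝ) ≤ -p.1 ∧ -p.1 ≤ sideCount c false p.2 := by
  have hD := sidePart_pairwise hc false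
  have hlen : (sidePart c false).length = leftCount c := by
    have := leftCount_le (c := c)
    simp [sidePart]; omega
  rcases hp with ⟨j, hj1, hj2, hx1, hx2, hy⟩ | ⟨j, hj, hx, hy⟩
  · have hjL : j < leftCount c + 1 := by
      have : (j : ℝ) < leftCount c + 1 := by linarith
      exact_mod_cast this
    obtain ⟨i, hi⟩ := Nat.exists_eq_add_of_le (Nat.lt_succ_iff.1 hjL)
    rw [show j = leftCount c - i by omega, colHeight_left] at hy
    have hi' : (leftCount c : ℝ) = j + i := by exact_mod_cast hi
    have hA : i + 1 ≤ sideCount c false p.2 :=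
      add_one_le_countP hD (by omega) hy.le
    have hB : sideCountGt c false p.2 ≤ i := countP_lt_le hD hy.ge
    have hA' : (i + 1 : ℝ) ≤ sideCount c false p.2 := by exact_mod_cast hA
    have hB' : (sideCountGt c false p.2 : ℝ) ≤ i := by exact_mod_cast hB
    constructor <;> linarith
  · have hjL : j < leftCount c := by
      have : (j : ℝ) < leftCount c := by linarith
      exact_mod_cast this
    obtain ⟨i, hi⟩ := Nat.exists_eq_add_of_lt hjL
    rw [show j + 1 = leftCount c - i by omega, show j = leftCount c - (i + 1) by omega,
      colHeight_left, colHeight_left,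
      Set.uIcc_of_le (Nat.cast_le.2 (getD_succ_le hD i))] at hy
    have hi' : (leftCount c : ℝ) = j + i + 1 := by exact_mod_cast hi
    have hA : i + 1 ≤ sideCount c false p.2 :=
      add_one_le_countP hD (by omega) hy.2
    have hB : sideCountGt c false p.2 ≤ i + 1 := countP_lt_le hD hy.1
    have hA' : (i + 1 : ℝ) ≤ sideCount c false p.2 := by exact_mod_cast hA
    have hB' : (sideCountGt c false p.2 : ℝ) ≤ i + 1 := by exact_mod_cast hB
    constructor <;> linarith

end Shape

/-! ### Unimodal sequences built from pairs of partitions -/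

/-- The larger one of the last entry of `a` and the first entry of `b` serves as the peak. -/
lemma exists_take_drop_pairwise {a b : List ℕ} (ha : a.Pairwise (· ≤ ·))
    (hb : b.Pairwise (· ≥ ·)) (hne : a ++ b ≠ []) :
    ∃ k < (a ++ b).length, ((a ++ b).take (k + 1)).Pairwise (· ≤ ·) ∧
      ((a ++ b).drop k).Pairwise (· ≥ ·) := by
  have key : ∀ (a : List ℕ) (x : ℕ) (b : List ℕ), (a ++ [x]).Pairwise (· ≤ ·) →
      (x :: b).Pairwise (· ≥ ·) →
      ∃ k < (a ++ x :: b).length, ((a ++ x :: b).take (k + 1)).Pairwise (· ≤ ·) ∧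
        ((a ++ x :: b).drop k).Pairwise (· ≥ ·) := by
    intro a x b h1 h2
    refine ⟨a.length, by simp, ?_, ?_⟩
    · rwa [List.take_length_add_append, List.take_succ_cons, List.take_zero]
    · rwa [List.drop_left]
  rcases b with _ | ⟨y, b⟩
  · rcases List.eq_nil_or_concat a with rfl | ⟨a, z, rfl⟩
    · simp at hne
    · rw [List.concat_eq_append] at ha ⊢
      rw [List.append_nil]
      exact key a z [] ha (List.pairwise_singleton _ _)
  · rcases List.eq_nil_or_concat a with rfl | ⟨a, z, rfl⟩
    · exact key [] y b (List.pairwise_singleton _ _) hb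
    · rw [List.concat_eq_append] at ha ⊢
      rcases le_total z y with h | h
      · refine key (a ++ [z]) y b (List.pairwise_append.2 ⟨ha, List.pairwise_singleton _ _, ?_⟩) hb
        intro u hu v hv
        rw [List.mem_singleton.1 hv]
        rcases List.mem_append.1 hu with hu | hu
        · exact le_trans ((List.pairwise_append.1 ha).2.2 u hu z (List.mem_singleton_self z)) h
        · rwa [List.mem_singleton.1 hu]
      · rw [List.append_assoc]
        refine key a z (y :: b) ha (List.pairwise_cons.2 ⟨fun v hv => ?_, hb⟩)
        rcases List.mem_cons.1 hv with rfl | hv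
        · exact h
        · exact le_trans ((List.pairwise_cons.1 hb).1 v hv) h

lemma isUnimodal_of_blocks_eq {n : ℕ} (hn : n ≠ 0) (c : Composition n) {a b : List ℕ}
    (hc : c.blocks = a ++ b) (ha : a.Pairwise (· ≤ ·)) (hb : b.Pairwise (· ≥ ·)) :
    IsUnimodal c := by
  have hne : c.blocks ≠ [] := by
    intro h
    have := c.blocks_sum
    rw [h] at this
    exact hn this.symm
  obtain ⟨k, hk, h1, h2⟩ := exists_take_drop_pairwise ha hb (hc ▸ hne)
  rw [← hc] at hk h1 h2
  have hget : ∀ i : Fin c.length, c.blocksFun i = c.blocks[(i : ℕ)]'i.2 := fun i => rfl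
  refine ⟨⟨k, hk⟩, fun i hi j hj hij => ?_, fun i hi j hj hij => ?_⟩
  · rcases hij.eq_or_lt with rfl | hlt
    · exact le_rfl
    have hi : (i : ℕ) ≤ k := hi
    have hj : (j : ℕ) ≤ k := hj
    have hjl : (j : ℕ) < c.blocks.length := j.2
    have hlt : (i : ℕ) < j := hlt
    have := List.pairwise_iff_getElem.1 h1 i j (by rw [List.length_take]; omega)
      (by rw [List.length_take]; omega) hlt
    rwa [List.getElem_take, List.getElem_take] at this
  · rcases hij.eq_or_lt with rfl | hlt
    · exact le_rfl
    have hi : k ≤ (i : ℕ) := hi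
    have hj : k ≤ (j : ℕ) := hj
    have hjl : (j : ℕ) < c.blocks.length := j.2
    have hlt : (i : ℕ) < j := hlt
    have := List.pairwise_iff_getElem.1 h2 (i - k) (j - k) (by rw [List.length_drop]; omega)
      (by rw [List.length_drop]; omega) (by omega)
    simp only [List.getElem_drop, Nat.add_sub_cancel' hi, Nat.add_sub_cancel' hj] at this
    exact this

/-- The weakly increasing list in which the part `k + 1` occurs `f k` times. -/
noncomputable def expand {M : ℕ} (f : Fin M → ℕ) : List ℕ :=
  (∑ k, Multiset.replicate (f k) ((k : ℕ) + 1)).sort (· ≤ ·)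

lemma expand_pairwise {M : ℕ} (f : Fin M → ℕ) : (expand f).Pairwise (· ≤ ·) :=
  Multiset.pairwise_sort _ _

lemma coe_expand {M : ℕ} (f : Fin M → ℕ) :
    (expand f : Multiset ℕ) = ∑ k, Multiset.replicate (f k) ((k : ℕ) + 1) :=
  Multiset.sort_eq _ _

lemma expand_sum {M : ℕ} (f : Fin M → ℕ) : (expand f).sum = ∑ k : Fin M, ((k : ℕ) + 1) * f k := by
  rw [← Multiset.sum_coe, coe_expand, ← Multiset.coe_sumAddMonoidHom, map_sum]
  refine Finset.sum_congr rfl fun k _ => ?_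
  simp [mul_comm]

lemma pos_of_mem_expand {M : ℕ} {f : Fin M → ℕ} {a : ℕ} (ha : a ∈ expand f) : 0 < a := by
  rw [← Multiset.mem_coe, coe_expand, Multiset.mem_sum] at ha
  obtain ⟨k, _, hk⟩ := ha
  rw [Multiset.eq_of_mem_replicate hk]
  exact Nat.succ_pos _

lemma expand_injective {M : ℕ} : Function.Injective (expand (M := M)) := by
  intro f g h
  have key : ∀ (f : Fin M → ℕ) (k : Fin M), (expand f : Multiset ℕ).count ((k : ℕ) + 1) = f k := by
    intro f k
    rw [coe_expand, Multiset.count_sum', Finset.sum_eq_single k]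
    · simp
    · intro b _ hb
      rw [Multiset.count_replicate, if_neg]
      intro h
      exact hb (Fin.ext (by omega))
    · simp
  ext k
  rw [← key f, ← key g, h]

lemma length_le_sum_of_pos {l : List ℕ} (h : ∀ a ∈ l, 0 < a) : l.length ≤ l.sum := by
  induction l with
  | nil => simp
  | cons a l ih =>
    have h1 := h a List.mem_cons_self
    have h2 := ih fun b hb => h b (List.mem_cons_of_mem _ hb)
    rw [List.length_cons, List.sum_cons]
    omega

/-- The total size of the pair of partitions with multiplicities `m`. -/
def multSize {M : ℕ} (m : Bool × Fin M → ℕ) : ℕ :=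
  ∑ i, ((i.2 : ℕ) + 1) * m i

/-- Pairs of partitions of total size at most `n` give unimodal sequences of size `n`: write the
first in increasing order, then the second in decreasing order, then fill up with ones. The pair is
recovered from the sequence, the number of parts of the first partition and the total size. -/
lemma card_le_mul_numUnimodal {n M : ℕ} (hn : n ≠ 0) (T : Finset (Bool × Fin M → ℕ))
    (hT : ∀ m ∈ T, multSize m ≤ n) : T.card ≤ numUnimodal n * ((n + 1) * (n + 1)) := by
  classical
  let A : (Bool × Fin M → ℕ) → List ℕ := fun m => expand fun k => m (false, k)
  let B : (Bool × Fin M → ℕ) → List ℕ := fun m => expand fun k => m (true, k)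
  let l : (Bool × Fin M → ℕ) → List ℕ := fun m =>
    A m ++ ((B m).reverse ++ List.replicate (n - multSize m) 1)
  have hfin : (unimodalSeqs n).Finite := Set.toFinite _
  have hsize : ∀ m, (A m).sum + (B m).sum = multSize m := by
    intro m
    simp only [A, B, expand_sum, multSize, Fintype.sum_prod_type, Fintype.sum_bool, add_comm]
  have hApos : ∀ m, ∀ a ∈ A m, 0 < a := fun m a => pos_of_mem_expand
  have hBpos : ∀ m, ∀ a ∈ B m, 0 < a := fun m a => pos_of_mem_expand
  have hcard : T.card ≤ ((hfin.toFinset.image Composition.blocks) ×ˢ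
      (Finset.range (n + 1) ×ˢ Finset.range (n + 1))).card := by
    refine Finset.card_le_card_of_injOn (fun m => (l m, (A m).length, multSize m)) ?_ ?_
    · intro m hm
      have hmn := hT m hm
      have hs := hsize m
      have hlen := length_le_sum_of_pos (hApos m)
      rw [Finset.mem_coe, Finset.mem_product, Finset.mem_product, Finset.mem_range,
        Finset.mem_range]
      refine ⟨?_, by show (A m).length < n + 1; omega, by show multSize m < n + 1; omega⟩
      rw [Finset.mem_image]
      let c : Composition n := ⟨l m, by
        intro i hi
        simp only [l, List.mem_append, List.mem_reverse, List.mem_replicate] at hi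
        rcases hi with hi | hi | hi
        · exact hApos m i hi
        · exact hBpos m i hi
        · omega, by
        simp only [l, List.sum_append, List.sum_reverse, List.sum_replicate, smul_eq_mul]
        omega⟩
      refine ⟨c, hfin.mem_toFinset.2 ?_, rfl⟩
      refine isUnimodal_of_blocks_eq hn c (a := A m) rfl (expand_pairwise _) ?_
      refine List.pairwise_append.2 ⟨List.pairwise_reverse.2 (expand_pairwise _),
        List.pairwise_replicate.2 (Or.inr le_rfl), fun a ha b hb => ?_⟩
      rw [List.eq_of_mem_replicate hb]
      exact hBpos m a (List.mem_reverse.1 ha)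
    · intro m _ m' _ h
      simp only [Prod.mk.injEq, l] at h
      obtain ⟨h1, h2, h3⟩ := h
      obtain ⟨hA, h4⟩ := List.append_inj h1 h2
      rw [h3] at h4
      have hB := List.reverse_injective (List.append_cancel_right h4)
      have hA' := expand_injective hA
      have hB' := expand_injective hB
      ext ⟨b, k⟩
      cases b
      · exact congrFun hA' k
      · exact congrFun hB' k
  refine hcard.trans ?_
  rw [Finset.card_product, Finset.card_product, Finset.card_range]
  refine Nat.mul_le_mul_right _ (Finset.card_image_le.trans ?_)
  rw [numUnimodal, Set.ncard_eq_toFinset_card _ hfin]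

/-! ### A lower bound for the number of unimodal sequences -/

lemma prod_pow_eq_exp_multSize {M : ℕ} (τ : ℝ) (m : Bool × Fin M → ℕ) :
    ∏ i, (Real.exp (-τ) ^ ((i.2 : ℕ) + 1)) ^ m i = Real.exp (-(τ * multSize m)) := by
  simp only [← pow_mul]
  rw [Finset.prod_pow_eq_pow_sum, ← Real.exp_nat_mul]
  simp only [multSize]
  ring_nf

lemma sum_exp_multSize_le {M : ℕ} {τ : ℝ} (hτ : 0 < τ) (T : Finset (Bool × Fin M → ℕ)) :
    ∑ m ∈ T, Real.exp (-(τ * multSize m)) ≤ Real.exp (rate ^ 2 / τ) := by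
  have hq1 : Real.exp (-τ) < 1 := Real.exp_lt_one_iff.2 (by linarith)
  have h := sum_prod_pow_le (fun i : Bool × Fin M => Real.exp (-τ) ^ ((i.2 : ℕ) + 1))
    (fun i => by positivity) (fun i => pow_lt_one₀ (Real.exp_pos _).le hq1 (Nat.succ_ne_zero _)) T
  simp only [prod_pow_eq_exp_multSize] at h
  simp only [Fintype.prod_prod_type] at h
  refine h.trans ?_
  simp only [Fin.prod_univ_eq_prod_range (fun k => (1 - Real.exp (-τ) ^ (k + 1))⁻¹) M,
    Fintype.prod_bool]
  have hle := prod_inv_one_sub_le hτ M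
  have h0 : 0 ≤ ∏ k ∈ Finset.range M, (1 - Real.exp (-τ) ^ (k + 1))⁻¹ :=
    Finset.prod_nonneg fun k _ => inv_nonneg.2
      (sub_nonneg.2 (pow_le_one₀ (Real.exp_pos _).le hq1.le))
  calc _ ≤ Real.exp (Real.pi ^ 2 / 6 / τ) * Real.exp (Real.pi ^ 2 / 6 / τ) := by gcongr
    _ = Real.exp (rate ^ 2 / τ) := by rw [← Real.exp_add, rate_sq]; ring_nf

/-- `sum_exp_multSize_le` is sharp to leading order as `τ → 0`. Finite sets of multiplicity
functions are enough, since `τ` is fixed when the bounds on the parts and on the multiplicities are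
chosen. -/
lemma eventually_exp_lt_sum_exp_multSize {η : ℝ} (hη : 0 < η) :
    ∀ᶠ τ in 𝓝[>] (0 : ℝ), ∃ (M : ℕ) (T : Finset (Bool × Fin M → ℕ)),
      Real.exp ((rate ^ 2 - η) / τ) < ∑ m ∈ T, Real.exp (-(τ * multSize m)) := by
  filter_upwards [eventually_exp_lt_prod_inv_one_sub (half_pos hη), self_mem_nhdsWithin]
    with τ ⟨M, hM⟩ hτ
  have hτ : 0 < τ := hτ
  have hq1 : Real.exp (-τ) < 1 := Real.exp_lt_one_iff.2 (by linarith)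
  have hlim : Tendsto (fun B : ℕ => ∏ i : Bool × Fin M, ∑ j ∈ Finset.range B,
      (Real.exp (-τ) ^ ((i.2 : ℕ) + 1)) ^ j) atTop
      (𝓝 (∏ i : Bool × Fin M, (1 - Real.exp (-τ) ^ ((i.2 : ℕ) + 1))⁻¹)) :=
    tendsto_finsetProd _ fun i _ => (hasSum_geometric_of_lt_one (by positivity)
      (pow_lt_one₀ (Real.exp_pos _).le hq1 (Nat.succ_ne_zero _))).tendsto_sum_nat
  have hlt : Real.exp ((rate ^ 2 - η) / τ) <
      ∏ i : Bool × Fin M, (1 - Real.exp (-τ) ^ ((i.2 : ℕ) + 1))⁻¹ := by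
    simp only [Fintype.prod_prod_type, Fintype.prod_bool,
      Fin.prod_univ_eq_prod_range (fun k => (1 - Real.exp (-τ) ^ (k + 1))⁻¹) M]
    calc Real.exp ((rate ^ 2 - η) / τ)
        = Real.exp ((Real.pi ^ 2 / 6 - η / 2) / τ) * Real.exp ((Real.pi ^ 2 / 6 - η / 2) / τ) := by
          rw [← Real.exp_add, rate_sq]; ring_nf
      _ < _ := mul_lt_mul'' hM hM (Real.exp_pos _).le (Real.exp_pos _).le
  obtain ⟨B, hB⟩ := (hlim.eventually_const_lt hlt).exists
  refine ⟨M, Fintype.piFinset fun _ => Finset.range B, hB.trans_le (le_of_eq ?_)⟩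
  rw [Finset.prod_univ_sum]
  simp only [prod_pow_eq_exp_multSize]

/-- The exponential gain in the tails of the size distribution at `τ = θ * rate / √n`. -/
noncomputable def tailGap (θ : ℝ) : ℝ := rate * ((θ - 1) ^ 2 / θ ^ 3)

/-- At `τ = θ * rate / √n` with `θ > 1`, the total weight of any set of pairs of partitions comes
from the sizes in `(n / θ ^ 4, n]`, up to two tails that are smaller than the generating function by
an exponential factor. Each tail is estimated by passing to another value of `τ`. -/
lemma sum_exp_multSize_le_numUnimodal {θ : ℝ} (hθ : 1 < θ) {n M : ℕ} (hn : n ≠ 0)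
    (T : Finset (Bool × Fin M → ℕ)) :
    ∑ m ∈ T, Real.exp (-(θ * rate / √n * multSize m)) ≤
      2 * Real.exp (√n * (rate / θ - tailGap θ)) +
        numUnimodal n * ((n + 1) * (n + 1)) * Real.exp (-(√n * (rate / θ ^ 3))) := by
  classical
  have hr := rate_pos
  have hθ0 : 0 < θ := by linarith
  have hn' : (0 : ℝ) < n := by exact_mod_cast Nat.pos_of_ne_zero hn
  have hx : 0 < √(n : ℝ) := Real.sqrt_pos.2 hn'
  have hxx : √(n : ℝ) * √(n : ℝ) = n := Real.mul_self_sqrt hn'.le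
  set x := √(n : ℝ) with hxdef
  have hgap1 : rate * (2 - θ) ≤ rate / θ - tailGap θ := by
    have : rate / θ - tailGap θ - rate * (2 - θ) =
        rate * ((θ - 1) ^ 2 * (θ ^ 2 - 1) / θ ^ 3) := by
      unfold tailGap; field_simp; ring
    have h2 : 0 ≤ rate * ((θ - 1) ^ 2 * (θ ^ 2 - 1) / θ ^ 3) := by
      have : 0 ≤ θ ^ 2 - 1 := by nlinarith
      positivity
    linarith
  have hgap2 : rate * (2 / θ ^ 2 - 1 / θ ^ 3) = rate / θ - tailGap θ := by
    unfold tailGap; field_simp; ring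
  -- sizes above `n`: compare with the weights at `τ = rate / √n`
  have hhigh : ∑ m ∈ T.filter (fun m => n < multSize m),
      Real.exp (-(θ * rate / x * multSize m)) ≤ Real.exp (x * (rate / θ - tailGap θ)) := by
    calc _ ≤ ∑ m ∈ T.filter (fun m => n < multSize m),
          Real.exp (-((θ - 1) * rate * x)) * Real.exp (-(rate / x * multSize m)) := by
          refine Finset.sum_le_sum fun m hm => ?_
          have hm : (n : ℝ) ≤ multSize m := by exact_mod_cast (Finset.mem_filter.1 hm).2.le
          rw [← Real.exp_add, Real.exp_le_exp]
          have h1 : (θ - 1) * rate / x * n ≤ (θ - 1) * rate / x * multSize m := by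
            have : 0 ≤ (θ - 1) * rate / x := div_nonneg (mul_nonneg (by linarith) hr.le) hx.le
            gcongr
          have h2 : (θ - 1) * rate / x * n = (θ - 1) * rate * x := by rw [← hxx]; field_simp
          have h3 : θ * rate / x * multSize m =
              (θ - 1) * rate / x * multSize m + rate / x * multSize m := by ring
          linarith
      _ ≤ Real.exp (-((θ - 1) * rate * x)) * Real.exp (rate ^ 2 / (rate / x)) := by
          rw [← Finset.mul_sum]
          gcongr
          exact sum_exp_multSize_le (div_pos hr hx) _
      _ ≤ _ := by
          rw [← Real.exp_add, Real.exp_le_exp]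
          have : rate ^ 2 / (rate / x) = rate * x := by field_simp
          rw [this]
          nlinarith
  -- sizes up to `n / θ ^ 4`: compare with the weights at `τ = θ ^ 2 * rate / √n`
  have hlow : ∑ m ∈ T.filter (fun m => (multSize m : ℝ) ≤ n / θ ^ 4),
      Real.exp (-(θ * rate / x * multSize m)) ≤ Real.exp (x * (rate / θ - tailGap θ)) := by
    calc _ ≤ ∑ m ∈ T.filter (fun m => (multSize m : ℝ) ≤ n / θ ^ 4),
          Real.exp ((θ ^ 2 - θ) * rate * x / θ ^ 4) *
            Real.exp (-(θ ^ 2 * rate / x * multSize m)) := by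
          refine Finset.sum_le_sum fun m hm => ?_
          have hm : (multSize m : ℝ) ≤ n / θ ^ 4 := (Finset.mem_filter.1 hm).2
          rw [← Real.exp_add, Real.exp_le_exp]
          have h1 : (θ ^ 2 - θ) * rate / x * multSize m ≤ (θ ^ 2 - θ) * rate / x * (n / θ ^ 4) := by
            have : 0 ≤ (θ ^ 2 - θ) * rate / x :=
              div_nonneg (mul_nonneg (by nlinarith) hr.le) hx.le
            gcongr
          have h2 : (θ ^ 2 - θ) * rate / x * (n / θ ^ 4) = (θ ^ 2 - θ) * rate * x / θ ^ 4 := by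
            rw [← hxx]; field_simp
          have h3 : θ ^ 2 * rate / x * multSize m =
              (θ ^ 2 - θ) * rate / x * multSize m + θ * rate / x * multSize m := by ring
          linarith
      _ ≤ Real.exp ((θ ^ 2 - θ) * rate * x / θ ^ 4) *
            Real.exp (rate ^ 2 / (θ ^ 2 * rate / x)) := by
          rw [← Finset.mul_sum]
          gcongr
          exact sum_exp_multSize_le (by positivity) _
      _ = _ := by
          rw [← Real.exp_add, ← hgap2]
          congr 1
          field_simp
          ring
  have hmid : ∑ m ∈ T.filter (fun m => multSize m ≤ n ∧ (n : ℝ) / θ ^ 4 < multSize m),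
      Real.exp (-(θ * rate / x * multSize m)) ≤
        numUnimodal n * ((n + 1) * (n + 1)) * Real.exp (-(x * (rate / θ ^ 3))) := by
    have hcard := card_le_mul_numUnimodal hn
      (T.filter (fun m => multSize m ≤ n ∧ (n : ℝ) / θ ^ 4 < multSize m))
      (fun m hm => (Finset.mem_filter.1 hm).2.1)
    have hcard' : ((T.filter (fun m => multSize m ≤ n ∧ (n : ℝ) / θ ^ 4 < multSize m)).card : ℝ)
        ≤ numUnimodal n * ((n + 1) * (n + 1)) := by exact_mod_cast hcard
    refine le_trans (Finset.sum_le_card_nsmul _ _ (Real.exp (-(x * (rate / θ ^ 3)))) ?_) ?_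
    · intro m hm
      have hm := (Finset.mem_filter.1 hm).2.2
      rw [Real.exp_le_exp, neg_le_neg_iff]
      calc x * (rate / θ ^ 3) = θ * rate / x * (n / θ ^ 4) := by rw [← hxx]; field_simp
        _ ≤ _ := by gcongr
    · rw [nsmul_eq_mul]
      gcongr
  have hsplit : ∑ m ∈ T, Real.exp (-(θ * rate / x * multSize m)) ≤
      ∑ m ∈ T.filter (fun m => n < multSize m), Real.exp (-(θ * rate / x * multSize m)) +
      (∑ m ∈ T.filter (fun m => (multSize m : ℝ) ≤ n / θ ^ 4),
        Real.exp (-(θ * rate / x * multSize m)) +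
      ∑ m ∈ T.filter (fun m => multSize m ≤ n ∧ (n : ℝ) / θ ^ 4 < multSize m),
        Real.exp (-(θ * rate / x * multSize m))) := by
    simp only [Finset.sum_filter, ← Finset.sum_add_distrib]
    refine Finset.sum_le_sum fun m _ => ?_
    have he := Real.exp_pos (-(θ * rate / x * multSize m))
    by_cases h1 : n < multSize m
    · rw [if_pos h1]
      split_ifs <;> linarith
    · by_cases h2 : (multSize m : ℝ) ≤ n / θ ^ 4
      · rw [if_pos h2]
        split_ifs <;> linarith
      · rw [if_pos (⟨not_lt.1 h1, not_le.1 h2⟩ : multSize m ≤ n ∧ (n : ℝ) / θ ^ 4 < multSize m)]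
        split_ifs; linarith
  linarith

lemma tendsto_sqrt_natCast : Tendsto (fun n : ℕ => √(n : ℝ)) atTop atTop :=
  Real.tendsto_sqrt_atTop.comp tendsto_natCast_atTop_atTop

lemma eventually_sq_le_exp {b : ℝ} (hb : 0 < b) :
    ∀ᶠ n : ℕ in atTop, ((n + 1) * (n + 1) : ℝ) ≤ Real.exp (b * √n) := by
  have h := tendsto_sqrt_natCast.eventually
    ((isLittleO_pow_exp_pos_mul_atTop 4 hb).bound (show (0 : ℝ) < 1 / 4 by norm_num))
  filter_upwards [h, eventually_ge_atTop 1] with n hn hn1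
  have hn1' : (1 : ℝ) ≤ n := by exact_mod_cast hn1
  have h4 : √(n : ℝ) ^ 4 = n ^ 2 := by
    rw [show 4 = 2 * 2 by norm_num, pow_mul, Real.sq_sqrt (by positivity)]
  rw [h4, Real.norm_of_nonneg (by positivity), Real.norm_of_nonneg (Real.exp_pos _).le] at hn
  nlinarith

/-- The number of unimodal sequences of size `n` is at least `exp ((2 * rate - o(1)) * √n)`. -/
lemma eventually_exp_le_numUnimodal {η : ℝ} (hη : 0 < η) :
    ∀ᶠ n : ℕ in atTop, Real.exp (√n * (2 * rate - η)) ≤ numUnimodal n := by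
  have hr := rate_pos
  -- at `θ = 1` the expression on the right is `2 * rate`
  obtain ⟨θ, hθη, hθ⟩ : ∃ θ : ℝ, 2 * rate - η / 2 < rate / θ - tailGap θ + rate / θ ^ 3 ∧
      1 < θ := by
    have hc : ContinuousAt (fun θ : ℝ => rate / θ - tailGap θ + rate / θ ^ 3) 1 := by
      unfold tailGap
      fun_prop (disch := norm_num)
    have hv : 2 * rate - η / 2 < rate / (1 : ℝ) - tailGap 1 + rate / 1 ^ 3 := by
      unfold tailGap; norm_num; linarith
    exact (((hc.eventually_const_lt hv).filter_mono nhdsWithin_le_nhds).and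
      (self_mem_nhdsWithin : Set.Ioi (1 : ℝ) ∈ 𝓝[>] 1)).exists
  have hθ0 : 0 < θ := by linarith
  have hgap : 0 < tailGap θ := by
    have : 0 < θ - 1 := by linarith
    unfold tailGap; positivity
  have hτ : Tendsto (fun n : ℕ => θ * rate / √(n : ℝ)) atTop (𝓝[>] 0) := by
    refine tendsto_nhdsWithin_iff.2 ⟨tendsto_const_nhds.div_atTop tendsto_sqrt_natCast, ?_⟩
    filter_upwards [eventually_gt_atTop 0] with n hn
    have : (0 : ℝ) < n := by exact_mod_cast hn
    exact div_pos (by positivity) (Real.sqrt_pos.2 this)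
  have hlow := hτ.eventually (eventually_exp_lt_sum_exp_multSize
    (show 0 < θ * rate * (tailGap θ / 2) by positivity))
  have hbig := tendsto_sqrt_natCast.eventually_ge_atTop (Real.log 3 / (tailGap θ / 2))
  filter_upwards [hlow, hbig, eventually_sq_le_exp (half_pos hη), eventually_gt_atTop 0]
    with n ⟨M, T, hT⟩ hn3 hnp hn0
  have hx : 0 < √(n : ℝ) := Real.sqrt_pos.2 (by exact_mod_cast hn0)
  have hup := sum_exp_multSize_le_numUnimodal hθ hn0.ne' T
  set x := √(n : ℝ)
  have e1 : (rate ^ 2 - θ * rate * (tailGap θ / 2)) / (θ * rate / x) =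
      x * (rate / θ - tailGap θ) + x * (tailGap θ / 2) := by
    field_simp; ring
  rw [e1, Real.exp_add] at hT
  have h3 : 3 ≤ Real.exp (x * (tailGap θ / 2)) := by
    rw [← Real.log_le_iff_le_exp (by norm_num)]
    exact (div_le_iff₀ (by positivity)).1 hn3
  have hE := Real.exp_pos (x * (rate / θ - tailGap θ))
  have hmain : Real.exp (x * (rate / θ - tailGap θ)) ≤
      numUnimodal n * Real.exp (η / 2 * x) * Real.exp (-(x * (rate / θ ^ 3))) := by
    calc _ ≤ numUnimodal n * ((n + 1) * (n + 1)) * Real.exp (-(x * (rate / θ ^ 3))) := by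
          nlinarith
      _ ≤ _ := by gcongr
  rw [mul_assoc, ← Real.exp_add, ← div_le_iff₀ (Real.exp_pos _), ← Real.exp_sub] at hmain
  refine le_trans (Real.exp_le_exp.2 ?_) hmain
  nlinarith

/-! ### Exponential moments of the column counts -/

/-- Comparison with the telescoping sum of `-log (1 - z * q ^ k)`. -/
lemma sum_div_one_sub_le {q z : ℝ} (hq0 : 0 < q) (hq1 : q < 1) (hz : 0 < z) {K n : ℕ}
    (hKn : K ≤ n) (hK : z * q ^ K < 1) :
    ∑ k ∈ Finset.Ico K n, z * q ^ (k + 1) / (1 - z * q ^ (k + 1)) ≤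
      q / (1 - q) * (-Real.log (1 - z * q ^ K)) := by
  have hlt : ∀ k, K ≤ k → z * q ^ k < 1 := fun k hk =>
    (mul_le_mul_of_nonneg_left (pow_le_pow_of_le_one hq0.le hq1.le hk) hz.le).trans_lt hK
  have h1q : 0 < 1 - q := by linarith
  have key : ∑ k ∈ Finset.Ico K n, z * q ^ (k + 1) / (1 - z * q ^ (k + 1)) ≤
      q / (1 - q) * (-Real.log (1 - z * q ^ K) + Real.log (1 - z * q ^ n)) := by
    induction n, hKn using Nat.le_induction with
    | base => simp
    | succ m hm ih =>
      rw [Finset.sum_Ico_succ_top hm]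
      have h0 : 0 < 1 - z * q ^ m := by linarith [hlt m hm]
      have h1 : 0 < 1 - z * q ^ (m + 1) := by linarith [hlt (m + 1) (by omega)]
      have hlog := Real.one_sub_inv_le_log_of_pos (div_pos h1 h0)
      rw [Real.log_div h1.ne' h0.ne', inv_div] at hlog
      have e : z * q ^ (m + 1) / (1 - z * q ^ (m + 1)) =
          q / (1 - q) * (1 - (1 - z * q ^ m) / (1 - z * q ^ (m + 1))) := by
        field_simp; ring
      have hc : 0 ≤ q / (1 - q) := (div_pos hq0 h1q).le
      have := mul_le_mul_of_nonneg_left hlog hc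
      rw [e]
      linarith
  refine key.trans (mul_le_mul_of_nonneg_left ?_ (div_pos hq0 h1q).le)
  have : Real.log (1 - z * q ^ n) ≤ 0 := by
    have := hlt n hKn
    have h2 : 0 < z * q ^ n := by positivity
    exact Real.log_nonpos (by linarith) (by linarith)
  linarith

/-- The lower bound companion to `sum_div_one_sub_le`. Here the upper end of the sum leaves a
boundary term, which vanishes as `q ^ n → 0`. -/
lemma le_sum_div_one_sub {q z : ℝ} (hq0 : 0 < q) (hq1 : q < 1) (hz : 0 < z) {K n : ℕ}
    (hKn : K ≤ n) (hK : z * q ^ (K + 1) < 1) :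
    1 / (1 - q) * (-Real.log (1 - z * q ^ (K + 1)) + Real.log (1 - z * q ^ (n + 1))) ≤
    ∑ k ∈ Finset.Ico K n, z * q ^ (k + 1) / (1 - z * q ^ (k + 1)) := by
  have hlt : ∀ k, K ≤ k → z * q ^ (k + 1) < 1 := fun k hk =>
    (mul_le_mul_of_nonneg_left (pow_le_pow_of_le_one hq0.le hq1.le (by omega)) hz.le).trans_lt hK
  have h1q : 0 < 1 - q := by linarith
  induction n, hKn using Nat.le_induction with
  | base => simp
  | succ m hm ih =>
    rw [Finset.sum_Ico_succ_top hm]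
    have h0 : 0 < 1 - z * q ^ (m + 1) := by linarith [hlt m hm]
    have h1 : 0 < 1 - z * q ^ (m + 1 + 1) := by linarith [hlt (m + 1) (by omega)]
    have hlog := Real.log_le_sub_one_of_pos (div_pos h1 h0)
    rw [Real.log_div h1.ne' h0.ne'] at hlog
    have e : z * q ^ (m + 1) / (1 - z * q ^ (m + 1)) =
        1 / (1 - q) * ((1 - z * q ^ (m + 1 + 1)) / (1 - z * q ^ (m + 1)) - 1) := by
      field_simp; ring
    have := mul_le_mul_of_nonneg_left hlog (one_div_pos.2 h1q).le
    rw [e]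
    linarith

/-- The change of Euler's product when the parts above `K` get the weight `z`; the estimate
`1 + w ≤ exp w` is applied with `w` positive for `z > 1` and negative for `z < 1`. -/
lemma prod_div_one_sub_le {q z : ℝ} (hq0 : 0 < q) (hq1 : q < 1) (hz : 0 < z) {K n : ℕ}
    (hK : z * q ^ (K + 1) < 1) :
    ∏ k ∈ Finset.Ico K n, ((1 - q ^ (k + 1)) / (1 - z * q ^ (k + 1))) ≤
      Real.exp ((z - 1) / z *
        ∑ k ∈ Finset.Ico K n, z * q ^ (k + 1) / (1 - z * q ^ (k + 1))) := by
  rw [Finset.mul_sum, Real.exp_sum]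
  refine Finset.prod_le_prod (fun k hk => ?_) fun k hk => ?_
  all_goals
    have hk := (Finset.mem_Ico.1 hk).1
    have h1 : z * q ^ (k + 1) < 1 := (mul_le_mul_of_nonneg_left
      (pow_le_pow_of_le_one hq0.le hq1.le (by omega)) hz.le).trans_lt hK
    have h2 : q ^ (k + 1) ≤ 1 := pow_le_one₀ hq0.le hq1.le
  · exact div_nonneg (by linarith) (by linarith)
  · have h3 : 1 - z * q ^ (k + 1) ≠ 0 := by linarith
    have e : (1 - q ^ (k + 1)) / (1 - z * q ^ (k + 1)) =
        (z - 1) / z * (z * q ^ (k + 1) / (1 - z * q ^ (k + 1))) + 1 := by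
      rw [← mul_div_assoc, ← mul_assoc, div_mul_cancel₀ _ hz.ne', div_add_one h3]
      ring
    rw [e]
    exact Real.add_one_le_exp _

/-- An upper bound, to leading order, for `1 / √n` times the logarithm of the moment generating
function at `log z` of the number of parts of size at least `y * √n` on one side. It is not the
exact rate, but it has the right derivative at `z = 1`. -/
noncomputable def momentRate (y z : ℝ) : ℝ :=
  (z - 1) / z * (rate⁻¹ * -Real.log (1 - z * Real.exp (-(rate * y))))

lemma tendsto_rate_div_sqrt : Tendsto (fun n : ℕ => rate / √(n : ℝ)) atTop (𝓝 0) :=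
  tendsto_const_nhds.div_atTop tendsto_sqrt_natCast

lemma tendsto_exp_sub_one_div : Tendsto (fun t : ℝ => (Real.exp t - 1) / t) (𝓝[>] 0) (𝓝 1) := by
  have h := (Real.hasDerivAt_exp 0).tendsto_slope_zero_right
  simp only [zero_add, Real.exp_zero, smul_eq_mul] at h
  refine h.congr fun t => ?_
  rw [div_eq_mul_inv, mul_comm]

lemma tendsto_rate_div_sqrt_pos :
    Tendsto (fun n : ℕ => rate / √(n : ℝ)) atTop (𝓝[>] 0) := by
  refine tendsto_nhdsWithin_iff.2 ⟨tendsto_rate_div_sqrt, ?_⟩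
  filter_upwards [eventually_gt_atTop 0] with n hn
  exact div_pos rate_pos (Real.sqrt_pos.2 (by exact_mod_cast hn))

/-- With `q = exp (-rate / √n)`, one has `q / (1 - q) ~ √n / rate`. -/
lemma tendsto_div_one_sub_div_sqrt :
    Tendsto (fun n : ℕ => Real.exp (-(rate / √(n : ℝ))) / (1 - Real.exp (-(rate / √(n : ℝ)))) /
      √(n : ℝ)) atTop (𝓝 rate⁻¹) := by
  have hr := rate_pos
  have h := ((tendsto_exp_sub_one_div.comp tendsto_rate_div_sqrt_pos).inv₀ one_ne_zero).mul_const
    rate⁻¹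
  rw [inv_one, one_mul] at h
  refine h.congr' ?_
  filter_upwards [eventually_gt_atTop 0] with n hn
  have hx : 0 < √(n : ℝ) := Real.sqrt_pos.2 (by exact_mod_cast hn)
  rw [exp_neg_div_one_sub (div_pos hr hx), Function.comp_apply, inv_div]
  field_simp

lemma tendsto_one_div_one_sub_div_sqrt :
    Tendsto (fun n : ℕ => 1 / (1 - Real.exp (-(rate / √(n : ℝ)))) / √(n : ℝ)) atTop
      (𝓝 rate⁻¹) := by
  have h1 : Tendsto (fun n : ℕ => Real.exp (rate / √(n : ℝ))) atTop (𝓝 1) := by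
    have := (Real.continuous_exp.tendsto 0).comp tendsto_rate_div_sqrt
    rwa [Real.exp_zero] at this
  have h := h1.mul tendsto_div_one_sub_div_sqrt
  rw [one_mul] at h
  refine h.congr fun n => ?_
  rw [Real.exp_neg]
  have := Real.exp_pos (rate / √(n : ℝ))
  field_simp

/-- The sum of `z ^ sideCount` over the unimodal sequences of size `n` is at most
`exp ((2 * rate + momentRate y z + o(1)) * √n)`, by `sum_pow_sideCount_le` at
`q = exp (-rate / √n)`. -/
lemma eventually_sum_pow_sideCount_le {y z η : ℝ} (hy : 0 < y) (hz : 0 < z)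
    (hzy : z * Real.exp (-(rate * y)) < 1) (hη : 0 < η) (b : Bool) :
    ∀ᶠ n : ℕ in atTop, ∀ T : Finset (Composition n), (∀ c ∈ T, IsUnimodal c) →
      ∑ c ∈ T, z ^ sideCount c b (y * √n) ≤
        Real.exp (√n * (2 * rate + momentRate y z + η)) := by
  have hr := rate_pos
  have hτ := tendsto_rate_div_sqrt
  -- the arguments of the logarithms at both ends of the telescoping sums
  have hup : Tendsto (fun n : ℕ => z * Real.exp (-(rate * y) + rate / √(n : ℝ))) atTop
      (𝓝 (z * Real.exp (-(rate * y)))) := by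
    have := ((Real.continuous_exp.tendsto _).comp (hτ.const_add (-(rate * y)))).const_mul z
    simpa using this
  have hdn : Tendsto (fun n : ℕ => z * Real.exp (-(rate * y) - rate / √(n : ℝ))) atTop
      (𝓝 (z * Real.exp (-(rate * y)))) := by
    have := ((Real.continuous_exp.tendsto _).comp (hτ.const_sub (-(rate * y)))).const_mul z
    simpa using this
  have hend : Tendsto (fun n : ℕ => z * Real.exp (-(rate * √(n : ℝ)))) atTop (𝓝 0) := by
    have := (Real.tendsto_exp_neg_atTop_nhds_zero.comp
      (tendsto_sqrt_natCast.const_mul_atTop hr)).const_mul z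
    simpa using this
  have hne : 1 - z * Real.exp (-(rate * y)) ≠ 0 := by linarith
  have hU : Tendsto (fun n : ℕ => (z - 1) / z *
      (Real.exp (-(rate / √(n : ℝ))) / (1 - Real.exp (-(rate / √(n : ℝ)))) / √(n : ℝ) *
        -Real.log (1 - z * Real.exp (-(rate * y) + rate / √(n : ℝ))))) atTop
      (𝓝 (momentRate y z)) :=
    (tendsto_div_one_sub_div_sqrt.mul ((hup.const_sub 1).log hne).neg).const_mul _
  have hD : Tendsto (fun n : ℕ => (z - 1) / z *
      (1 / (1 - Real.exp (-(rate / √(n : ℝ)))) / √(n : ℝ) *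
        (-Real.log (1 - z * Real.exp (-(rate * y) - rate / √(n : ℝ))) +
          Real.log (1 - z * Real.exp (-(rate * √(n : ℝ))))))) atTop
      (𝓝 (momentRate y z)) := by
    have h := (tendsto_one_div_one_sub_div_sqrt.mul
      (((hdn.const_sub 1).log hne).neg.add ((hend.const_sub 1).log (by norm_num)))).const_mul
      ((z - 1) / z)
    rw [sub_zero, Real.log_one, add_zero] at h
    exact h
  have hlt : momentRate y z < momentRate y z + η := by linarith
  filter_upwards [hU.eventually_lt_const hlt, hD.eventually_lt_const hlt,
    hup.eventually_lt_const hzy, hend.eventually_lt_const one_pos,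
    tendsto_sqrt_natCast.eventually_ge_atTop y, eventually_gt_atTop 0]
    with n hnU hnD hnup hnend hny hn0 T hT
  have hn' : (0 : ℝ) < n := by exact_mod_cast hn0
  have hx : 0 < √(n : ℝ) := Real.sqrt_pos.2 hn'
  have hxx : √(n : ℝ) * √(n : ℝ) = n := Real.mul_self_sqrt hn'.le
  set x := √(n : ℝ) with hxdef
  set τ := rate / x with hτdef
  have hτ0 : 0 < τ := div_pos hr hx
  have hτx : τ * x = rate := by rw [hτdef]; field_simp
  set q := Real.exp (-τ) with hq
  have hq0 : 0 < q := Real.exp_pos _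
  have hq1 : q < 1 := Real.exp_lt_one_iff.2 (by linarith)
  have hqk : ∀ k : ℕ, q ^ k = Real.exp (-(τ * k)) := by
    intro k; rw [hq, ← Real.exp_nat_mul]; ring_nf
  obtain ⟨K, hK⟩ : ∃ K, ⌈y * x⌉₊ = K + 1 :=
    Nat.exists_eq_add_one.2 (Nat.ceil_pos.2 (by positivity))
  have hK1 : (K : ℝ) + 1 < y * x + 1 := by
    have := Nat.ceil_lt_add_one (show 0 ≤ y * x by positivity)
    rw [hK] at this; exact_mod_cast this
  have hK2 : y * x ≤ K + 1 := by
    have := Nat.le_ceil (y * x)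
    rw [hK] at this; exact_mod_cast this
  have hKn : K ≤ n := by
    have : (K : ℝ) ≤ n := by nlinarith
    exact_mod_cast this
  have hτyx : τ * (y * x) = rate * y := by rw [← hτx]; ring
  have hzq : ∀ k : ℕ, y * x ≤ k → z * q ^ k < 1 := by
    intro k hk
    refine lt_of_le_of_lt ?_ hzy
    rw [hqk, ← hτyx]
    exact mul_le_mul_of_nonneg_left
      (Real.exp_le_exp.2 (neg_le_neg (mul_le_mul_of_nonneg_left hk hτ0.le))) hz.le
  have hKz : z * q ^ (K + 1) < 1 := hzq (K + 1) (by exact_mod_cast hK2)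
  have hfilter : (Finset.range n).filter (fun k : ℕ => y * x ≤ ((k + 1 : ℕ) : ℝ)) =
      Finset.Ico K n := by
    ext k
    rw [Finset.mem_filter, Finset.mem_range, Finset.mem_Ico, ← Nat.ceil_le, hK]
    omega
  have hmain := sum_pow_sideCount_le hq0 hq1 hz b hzq T hT
  rw [hfilter] at hmain
  have hexp : (z - 1) / z * ∑ k ∈ Finset.Ico K n, z * q ^ (k + 1) / (1 - z * q ^ (k + 1)) ≤
      x * (momentRate y z + η) := by
    rcases le_total 1 z with h1 | h1
    · -- for `z ≥ 1` the telescoping sum is needed as an upper bound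
      have hKle : z * q ^ K ≤ z * Real.exp (-(rate * y) + τ) := by
        rw [hqk, ← hτyx]
        gcongr
        nlinarith
      have hs := sum_div_one_sub_le hq0 hq1 hz hKn (hKle.trans_lt hnup)
      calc _ ≤ (z - 1) / z * (q / (1 - q) *
            (-Real.log (1 - z * Real.exp (-(rate * y) + τ)))) := by
            refine mul_le_mul_of_nonneg_left (hs.trans ?_) (div_nonneg (by linarith) hz.le)
            refine mul_le_mul_of_nonneg_left (neg_le_neg (Real.log_le_log (by linarith) ?_))
              (div_nonneg hq0.le (by linarith))
            linarith
        _ = x * ((z - 1) / z * (q / (1 - q) / x *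
            (-Real.log (1 - z * Real.exp (-(rate * y) + τ))))) := by field_simp
        _ ≤ x * (momentRate y z + η) := by gcongr
    · -- for `z ≤ 1` the factor `(z - 1) / z` turns a lower bound into an upper bound
      have hKle : z * Real.exp (-(rate * y) - τ) ≤ z * q ^ (K + 1) := by
        rw [hqk, ← hτyx]
        gcongr
        push_cast
        nlinarith
      have hnle : z * q ^ (n + 1) ≤ z * Real.exp (-(rate * x)) := by
        have h2 : rate * x = τ * n := by rw [← hτx, mul_assoc, hxx]
        rw [hqk, h2]
        push_cast
        exact mul_le_mul_of_nonneg_left (Real.exp_le_exp.2 (by linarith)) hz.le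
      have hs := le_sum_div_one_sub hq0 hq1 hz hKn hKz
      calc _ ≤ (z - 1) / z * (1 / (1 - q) *
            (-Real.log (1 - z * Real.exp (-(rate * y) - τ)) +
              Real.log (1 - z * Real.exp (-(rate * x))))) := by
            refine mul_le_mul_of_nonpos_left (le_trans ?_ hs)
              (div_nonpos_of_nonpos_of_nonneg (by linarith) hz.le)
            refine mul_le_mul_of_nonneg_left (add_le_add (neg_le_neg (Real.log_le_log
              (by linarith) (by linarith))) (Real.log_le_log (by linarith) (by linarith)))
              (div_nonneg zero_le_one (by linarith))
        _ = x * ((z - 1) / z * (1 / (1 - q) / x *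
            (-Real.log (1 - z * Real.exp (-(rate * y) - τ)) +
              Real.log (1 - z * Real.exp (-(rate * x)))))) := by field_simp
        _ ≤ x * (momentRate y z + η) := by gcongr
  have hEuler : (∏ k ∈ Finset.range n, (1 - q ^ (k + 1))⁻¹) ^ 2 ≤ Real.exp (rate * x) := by
    have h0 : 0 ≤ ∏ k ∈ Finset.range n, (1 - q ^ (k + 1))⁻¹ :=
      Finset.prod_nonneg fun k _ => inv_nonneg.2 (sub_nonneg.2 (pow_le_one₀ hq0.le hq1.le))
    calc _ ≤ Real.exp (Real.pi ^ 2 / 6 / τ) ^ 2 := by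
          gcongr
          exact prod_inv_one_sub_le hτ0 n
      _ = Real.exp (rate * x) := by
          rw [← Real.exp_nat_mul]
          congr 1
          have : Real.pi ^ 2 = 3 * rate ^ 2 := by rw [rate_sq]; ring
          rw [this, hτdef]
          push_cast
          field_simp
          norm_num
  have hprod : ∏ k ∈ Finset.Ico K n, ((1 - q ^ (k + 1)) / (1 - z * q ^ (k + 1))) ≤
      Real.exp (x * (momentRate y z + η)) :=
    (prod_div_one_sub_le hq0 hq1 hz hKz).trans (Real.exp_le_exp.2 hexp)
  have hqn : q ^ n = Real.exp (-(rate * x)) := by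
    rw [hqk, ← hxx, ← mul_assoc, hτx]
  have hfin : q ^ n * ∑ c ∈ T, z ^ sideCount c b (y * x) ≤
      Real.exp (rate * x) * Real.exp (x * (momentRate y z + η)) :=
    hmain.trans (mul_le_mul hEuler hprod (Finset.prod_nonneg fun k hk => by
      have hk := (Finset.mem_Ico.1 hk).1
      have h1 : z * q ^ (k + 1) < 1 := hzq (k + 1)
        (hK2.trans (by exact_mod_cast Nat.succ_le_succ hk))
      exact div_nonneg (sub_nonneg.2 (pow_le_one₀ hq0.le hq1.le)) (by linarith))
      (Real.exp_pos _).le)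
  rw [hqn, ← Real.exp_add, mul_comm, ← le_div_iff₀ (Real.exp_pos _), ← Real.exp_sub] at hfin
  refine hfin.trans (Real.exp_le_exp.2 (le_of_eq ?_))
  ring

/-! ### Concentration of the column counts -/

/-- Chernoff's bound, relative to the number of all unimodal sequences: `a` is not a typical value
of the number of parts of size at least `y * √n` on one side, divided by `√n`, if
`momentRate y z < a * log z` for some `z`. -/
lemma tendsto_ncard_div_of_momentRate_lt {y z a : ℝ} (hy : 0 < y) (hz : 0 < z)
    (hzy : z * Real.exp (-(rate * y)) < 1) (hlt : momentRate y z < a * Real.log z) (b : Bool)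
    (E : ∀ n : ℕ, Set (Composition n)) (hE : ∀ n, E n ⊆ unimodalSeqs n)
    (hEz : ∀ n, ∀ c ∈ E n, Real.exp (√n * (a * Real.log z)) ≤ z ^ sideCount c b (y * √n)) :
    Tendsto (fun n : ℕ => ((E n).ncard : ℝ) / numUnimodal n) atTop (𝓝 0) := by
  obtain ⟨d, hd⟩ : ∃ d, d = (a * Real.log z - momentRate y z) / 3 := ⟨_, rfl⟩
  have hd0 : 0 < d := by rw [hd]; linarith
  have hexp : Tendsto (fun n : ℕ => Real.exp (-(d * √(n : ℝ)))) atTop (𝓝 0) :=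
    Real.tendsto_exp_neg_atTop_nhds_zero.comp (tendsto_sqrt_natCast.const_mul_atTop hd0)
  refine tendsto_of_tendsto_of_tendsto_of_le_of_le' tendsto_const_nhds hexp
    (Eventually.of_forall fun n => by positivity) ?_
  filter_upwards [eventually_sum_pow_sideCount_le hy hz hzy hd0 b,
    eventually_exp_le_numUnimodal hd0] with n hup hlow
  have hfin : (E n).Finite := Set.toFinite _
  have h1 := hup hfin.toFinset fun c hc => hE n (hfin.mem_toFinset.1 hc)
  have h2 := Finset.card_nsmul_le_sum hfin.toFinset (fun c => z ^ sideCount c b (y * √(n : ℝ)))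
    (Real.exp (√n * (a * Real.log z))) fun c hc => hEz n c (hfin.mem_toFinset.1 hc)
  rw [← Set.ncard_eq_toFinset_card _ hfin, nsmul_eq_mul] at h2
  have h3 := h2.trans h1
  rw [← le_div_iff₀ (Real.exp_pos _), ← Real.exp_sub] at h3
  have hs : 0 < (numUnimodal n : ℝ) := (Real.exp_pos _).trans_le hlow
  rw [div_le_iff₀ hs]
  calc ((E n).ncard : ℝ) ≤ _ := h3
    _ = Real.exp (-(d * √n)) * Real.exp (√n * (2 * rate - d)) := by
        rw [← Real.exp_add, hd]; ring_nf
    _ ≤ _ := by gcongr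

lemma hasDerivAt_momentRate_sub {y : ℝ} (hy : 0 < y) (a : ℝ) :
    HasDerivAt (fun z => momentRate y z - a * Real.log z) (limitShape y - a) 1 := by
  have hlt := exp_neg_mul_lt_one rate_pos hy
  have hne : 1 - 1 * Real.exp (-(rate * y)) ≠ 0 := by linarith
  have h1 : HasDerivAt (fun z : ℝ => (z - 1) / z) ((1 * 1 - (1 - 1) * 1) / 1 ^ 2) 1 :=
    ((hasDerivAt_id (1 : ℝ)).sub_const 1).div (hasDerivAt_id 1) one_ne_zero
  have h2 := ((((hasDerivAt_id (1 : ℝ)).mul_const (Real.exp (-(rate * y)))).const_sub 1).log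
    hne).neg.const_mul rate⁻¹
  have h3 := (h1.mul h2).sub ((Real.hasDerivAt_log one_ne_zero).const_mul a)
  refine HasDerivAt.congr_deriv (f := fun z => momentRate y z - a * Real.log z) h3 ?_
  rw [limitShape_eq, abs_of_pos hy]
  simp

/-- Since `momentRate y z - a * log z` vanishes at `z = 1` with derivative `limitShape y - a`, it is
negative on one side of `1`: to the right for `a > limitShape y`, to the left for
`a < limitShape y`. The filter `l` selects the side. -/
lemma exists_momentRate_lt {y a : ℝ} (hy : 0 < y) {l : Filter ℝ} [l.NeBot] (hl : l ≤ 𝓝[≠] 1)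
    (hsign : ∀ᶠ z in l, (z - 1) * (limitShape y - a) < 0) :
    ∃ z, (z - 1) * (limitShape y - a) < 0 ∧ 0 < z ∧ z * Real.exp (-(rate * y)) < 1 ∧
      momentRate y z < a * Real.log z := by
  have hlt := exp_neg_mul_lt_one rate_pos hy
  have hl' : l ≤ 𝓝 1 := hl.trans nhdsWithin_le_nhds
  have hslope := ((hasDerivAt_iff_tendsto_slope.1 (hasDerivAt_momentRate_sub hy a)).mono_left
    hl)
  have hpos : ∀ᶠ z : ℝ in l, 0 < z := hl' (lt_mem_nhds one_pos)
  have hzy : ∀ᶠ z : ℝ in l, z * Real.exp (-(rate * y)) < 1 := by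
    have : Tendsto (fun z : ℝ => z * Real.exp (-(rate * y))) l (𝓝 (1 * Real.exp (-(rate * y)))) :=
      (tendsto_id.mono_left hl').mul_const _
    exact this.eventually_lt_const (by linarith)
  have hD : limitShape y - a ≠ 0 := by
    obtain ⟨z, hz⟩ := hsign.exists
    rintro h
    rw [h, mul_zero] at hz
    exact lt_irrefl _ hz
  have hprod := (hslope.mul_const (limitShape y - a)).eventually_const_lt
    (mul_self_pos.2 hD)
  obtain ⟨z, hz1, hz2, hz3, hz4⟩ := (hsign.and (hpos.and (hzy.and hprod))).exists
  refine ⟨z, hz1, hz2, hz3, ?_⟩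
  have h1 : momentRate y 1 - a * Real.log 1 = 0 := by simp [momentRate]
  rw [slope_def_field, h1, sub_zero] at hz4
  have hne : z - 1 ≠ 0 := by rintro h; rw [h, zero_mul] at hz1; exact lt_irrefl _ hz1
  by_contra hcon
  have hcon : 0 ≤ momentRate y z - a * Real.log z := by linarith
  have e : (momentRate y z - a * Real.log z) / (z - 1) * (limitShape y - a) =
      (momentRate y z - a * Real.log z) * ((z - 1) * (limitShape y - a)) / (z - 1) ^ 2 := by
    field_simp
  rw [e] at hz4
  have : (momentRate y z - a * Real.log z) * ((z - 1) * (limitShape y - a)) / (z - 1) ^ 2 ≤ 0 :=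
    div_nonpos_of_nonpos_of_nonneg (mul_nonpos_of_nonneg_of_nonpos hcon hz1.le) (sq_nonneg _)
  linarith

/-- The sequences in which the number of parts of size at least `y * √n` on side `b` differs from
`limitShape y * √n` by at least `δ * √n`. -/
def deviating (b : Bool) (y δ : ℝ) (n : ℕ) : Set (Composition n) :=
  {c ∈ unimodalSeqs n | δ * √n ≤ |(sideCount c b (y * √n) : ℝ) - limitShape y * √n|}

lemma pow_eq_exp_mul_log {z : ℝ} (hz : 0 < z) (k : ℕ) : z ^ k = Real.exp (k * Real.log z) := by
  rw [Real.exp_nat_mul, Real.exp_log hz]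

lemma tendsto_deviating (b : Bool) {y δ : ℝ} (hy : 0 < y) (hδ : 0 < δ) :
    Tendsto (fun n : ℕ => ((deviating b y δ n).ncard : ℝ) / numUnimodal n) atTop (𝓝 0) := by
  have hup : Tendsto (fun n : ℕ => (({c ∈ unimodalSeqs n |
      (limitShape y + δ) * √n ≤ sideCount c b (y * √n)}.ncard : ℕ) : ℝ) / numUnimodal n)
      atTop (𝓝 0) := by
    obtain ⟨z, hz1, hz2, hz3, hz4⟩ := exists_momentRate_lt (a := limitShape y + δ) hy
      (l := 𝓝[>] 1) (nhdsWithin_mono _ fun z hz => ne_of_gt hz) (by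
        filter_upwards [self_mem_nhdsWithin] with z hz
        have hz : 1 < z := hz
        nlinarith)
    refine tendsto_ncard_div_of_momentRate_lt hy hz2 hz3 hz4 b _ (fun n c hc => hc.1) ?_
    intro n c hc
    have hlog : 0 < Real.log z := Real.log_pos (by nlinarith)
    rw [pow_eq_exp_mul_log hz2, Real.exp_le_exp, ← mul_assoc]
    exact mul_le_mul_of_nonneg_right (by linarith [hc.2]) hlog.le
  have hdn : Tendsto (fun n : ℕ => (({c ∈ unimodalSeqs n |
      (sideCount c b (y * √n) : ℝ) ≤ (limitShape y - δ) * √n}.ncard : ℕ) : ℝ) / numUnimodal n)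
      atTop (𝓝 0) := by
    obtain ⟨z, hz1, hz2, hz3, hz4⟩ := exists_momentRate_lt (a := limitShape y - δ) hy
      (l := 𝓝[<] 1) (nhdsWithin_mono _ fun z hz => ne_of_lt hz) (by
        filter_upwards [self_mem_nhdsWithin] with z hz
        have hz : z < 1 := hz
        nlinarith)
    refine tendsto_ncard_div_of_momentRate_lt hy hz2 hz3 hz4 b _ (fun n c hc => hc.1) ?_
    intro n c hc
    have hlog : Real.log z < 0 := Real.log_neg hz2 (by nlinarith)
    rw [pow_eq_exp_mul_log hz2, Real.exp_le_exp, ← mul_assoc]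
    exact mul_le_mul_of_nonpos_right (by linarith [hc.2]) hlog.le
  have hsum := hup.add hdn
  rw [add_zero] at hsum
  refine squeeze_zero (fun n => by positivity) (fun n => ?_) hsum
  rw [← add_div]
  gcongr
  have hsub : deviating b y δ n ⊆
      {c ∈ unimodalSeqs n | (limitShape y + δ) * √n ≤ sideCount c b (y * √n)} ∪
      {c ∈ unimodalSeqs n | (sideCount c b (y * √n) : ℝ) ≤ (limitShape y - δ) * √n} := by
    rintro c ⟨hc, hdev⟩
    rcases le_abs.1 hdev with h | h
    · exact Or.inl ⟨hc, by linarith⟩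
    · exact Or.inr ⟨hc, by linarith⟩
  exact_mod_cast (Set.ncard_le_ncard hsub (Set.toFinite _)).trans (Set.ncard_union_le _ _)

/-! ### Typical sequences lie near the curve -/

lemma snd_nonneg_of_mem_shape {n : ℕ} {c : Composition n} {p : ℝ × ℝ} (hp : p ∈ shape c) :
    0 ≤ p.2 := by
  rcases hp with ⟨j, _, _, _, _, hy⟩ | ⟨j, _, _, hy⟩
  · rw [hy]; positivity
  · exact le_trans (le_inf (by positivity) (by positivity)) hy.1

/-- If the column counts at the heights `limitShape ((j + 1) * (ε / 2))` are typical, then so is the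
border at every height from `ε` on: the border is monotone on each side, and consecutive mesh points
of the curve have horizontal distance `ε / 2`. -/
lemma abs_sub_limitShape_le {n : ℕ} {c : Composition n} (hc : c ∈ unimodalSeqs n) {ε x y : ℝ}
    (hε : 0 < ε) (hn : n ≠ 0) (b : Bool)
    (hdev : ∀ j < ⌊limitShape ε / (ε / 2)⌋₊ + 1,
      c ∉ deviating b (limitShape ((j + 1 : ℝ) * (ε / 2))) (ε / 2) n)
    (hx : 0 < x) (hy : ε ≤ y)
    (h1 : (sideCountGt c b (y * √n) : ℝ) ≤ x * √n) (h2 : x * √n ≤ sideCount c b (y * √n)) :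
    |x - limitShape y| ≤ ε := by
  have hr : 0 < √(n : ℝ) := Real.sqrt_pos.2 (by exact_mod_cast Nat.pos_of_ne_zero hn)
  set r := √(n : ℝ)
  obtain ⟨δ, hδ⟩ : ∃ δ, δ = ε / 2 := ⟨_, rfl⟩
  rw [← hδ] at hdev
  have hδ0 : 0 < δ := by rw [hδ]; linarith
  have hy0 : 0 < y := hε.trans_le hy
  obtain ⟨v, hv⟩ : ∃ v, v = limitShape y := ⟨_, rfl⟩
  have hv0 : 0 < v := hv ▸ limitShape_pos hy0
  have hvy : limitShape v = y := by rw [hv, limitShape_limitShape hy0]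
  have hvε : v ≤ limitShape ε := by
    rcases hy.eq_or_lt with h | h
    · rw [hv, h]
    · exact hv ▸ (limitShape_lt hε h).le
  have hdev' : ∀ j < ⌊limitShape ε / δ⌋₊ + 1,
      |(sideCount c b (limitShape ((j + 1 : ℝ) * δ) * r) : ℝ) - (j + 1 : ℝ) * δ * r| < δ * r := by
    intro j hj
    by_contra h
    refine hdev j hj ⟨hc, ?_⟩
    rw [limitShape_limitShape (by positivity)]
    exact not_lt.1 h
  rw [← hv, abs_le]
  constructor
  · rcases le_or_gt v δ with hvδ | hvδ
    · linarith
    -- the last mesh point strictly above height `y`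
    obtain ⟨j, hj⟩ : ∃ j : ℕ, ⌈v / δ⌉₊ = j + 2 := by
      refine Nat.exists_eq_add_of_le' (Nat.lt_ceil.2 ?_)
      rw [lt_div_iff₀ hδ0]; simpa using hvδ
    have hj1 : (j + 1 : ℝ) * δ < v := by
      have : j + 1 < ⌈v / δ⌉₊ := by omega
      rw [Nat.lt_ceil, lt_div_iff₀ hδ0] at this
      exact_mod_cast this
    have hj2 : v ≤ (j + 2 : ℝ) * δ := by
      have := Nat.le_ceil (v / δ)
      rw [hj, div_le_iff₀ hδ0] at this
      exact_mod_cast this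
    have hjJ : j < ⌊limitShape ε / δ⌋₊ + 1 := by
      refine Nat.lt_succ_of_le (Nat.le_floor ?_)
      rw [le_div_iff₀ hδ0]
      nlinarith
    have hlt : y < limitShape ((j + 1 : ℝ) * δ) := hvy ▸ limitShape_lt (by positivity) hj1
    have hmono : sideCount c b (limitShape ((j + 1 : ℝ) * δ) * r) ≤ sideCountGt c b (y * r) := by
      refine List.countP_mono_left fun a _ ha => ?_
      rw [decide_eq_true_eq] at ha ⊢
      exact (mul_lt_mul_of_pos_right hlt hr).trans_le ha
    have hmono' : (sideCount c b (limitShape ((j + 1 : ℝ) * δ) * r) : ℝ) ≤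
        sideCountGt c b (y * r) := by exact_mod_cast hmono
    have hd := (abs_lt.1 (hdev' j hjJ)).1
    have h3 : (v - 2 * δ) * r < x * r := by nlinarith
    have := lt_of_mul_lt_mul_right h3 hr.le
    linarith
  · -- the first mesh point strictly below height `y`
    obtain ⟨j, hj⟩ : ∃ j : ℕ, j = ⌊v / δ⌋₊ := ⟨_, rfl⟩
    have hj1 : v < (j + 1 : ℝ) * δ := by
      have := Nat.lt_floor_add_one (v / δ)
      rwa [← hj, div_lt_iff₀ hδ0] at this
    have hj2 : (j : ℝ) * δ ≤ v := by
      have := Nat.floor_le (show 0 ≤ v / δ by positivity)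
      rwa [← hj, le_div_iff₀ hδ0] at this
    have hjJ : j < ⌊limitShape ε / δ⌋₊ + 1 := by
      rw [hj]
      exact Nat.lt_succ_of_le (Nat.floor_le_floor (by gcongr))
    have hlt : limitShape ((j + 1 : ℝ) * δ) < y := hvy ▸ limitShape_lt hv0 hj1
    have hmono : sideCount c b (y * r) ≤ sideCount c b (limitShape ((j + 1 : ℝ) * δ) * r) := by
      refine List.countP_mono_left fun a _ ha => ?_
      rw [decide_eq_true_eq] at ha ⊢
      exact (mul_le_mul_of_nonneg_right hlt.le hr.le).trans ha
    have hmono' : (sideCount c b (y * r) : ℝ) ≤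
        sideCount c b (limitShape ((j + 1 : ℝ) * δ) * r) := by exact_mod_cast hmono
    have hd := (abs_lt.1 (hdev' j hjJ)).2
    have h3 : x * r < (v + 2 * δ) * r := by nlinarith
    have := lt_of_mul_lt_mul_right h3 hr.le
    linarith

lemma renormShape_subset_curveNhd {n : ℕ} {c : Composition n} (hc : c ∈ unimodalSeqs n) {ε : ℝ}
    (hε : 0 < ε) (hn : n ≠ 0)
    (hdev : ∀ b, ∀ j < ⌊limitShape ε / (ε / 2)⌋₊ + 1,
      c ∉ deviating b (limitShape ((j + 1 : ℝ) * (ε / 2))) (ε / 2) n) :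
    renormShape c ⊆ curveNhd ε {x | x ≠ 0} limitShape := by
  have hr : 0 < √(n : ℝ) := Real.sqrt_pos.2 (by exact_mod_cast Nat.pos_of_ne_zero hn)
  rintro _ ⟨p, hp, rfl⟩
  by_cases hy : |p.2 / √(n : ℝ)| < ε
  · exact Or.inl (Or.inr hy)
  rw [abs_of_nonneg (div_nonneg (snd_nonneg_of_mem_shape hp) hr.le), not_lt] at hy
  have hv := limitShape_pos (hε.trans_le hy)
  have hvv := limitShape_limitShape (hε.trans_le hy)
  have e1 : p.1 / √(n : ℝ) * √n = p.1 := div_mul_cancel₀ _ hr.ne'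
  have e2 : p.2 / √(n : ℝ) * √n = p.2 := div_mul_cancel₀ _ hr.ne'
  rcases lt_trichotomy p.1 0 with h0 | h0 | h0
  · obtain ⟨h1, h2⟩ := mem_shape_left hc hp h0
    have := abs_sub_limitShape_le hc hε hn false (hdev false) (x := -(p.1 / √n))
      (neg_pos.2 (div_neg_of_neg_of_pos h0 hr)) hy
      (by rw [neg_mul, e1, e2]; exact h1) (by rw [neg_mul, e1, e2]; exact h2)
    refine Or.inl (Or.inl ⟨-limitShape (p.2 / √n), (neg_neg_of_pos hv).ne, ?_, ?_⟩)
    · rw [limitShape_neg]; exact hvv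
    · rw [← abs_neg]
      convert this using 2
      ring
  · exact Or.inr (by simpa [h0] using hε)
  · obtain ⟨h1, h2⟩ := mem_shape_right hc hp h0
    have := abs_sub_limitShape_le hc hε hn true (hdev true) (x := p.1 / √n)
      (div_pos h0 hr) hy (by rw [e1, e2]; exact h1) (by rw [e1, e2]; exact h2)
    exact Or.inl (Or.inl ⟨limitShape (p.2 / √n), hv.ne', hvv, this⟩)

lemma tendsto_renormShape_subset {ε : ℝ} (hε : 0 < ε) :
    Tendsto (fun n : ℕ =>
        (({c ∈ unimodalSeqs n | renormShape c ⊆ curveNhd ε {x | x ≠ 0} limitShape}.ncard : ℕ) : ℝ)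
          / (numUnimodal n : ℝ)) atTop (𝓝 1) := by
  let I : Finset (Bool × ℕ) := Finset.univ ×ˢ Finset.range (⌊limitShape ε / (ε / 2)⌋₊ + 1)
  let bad : ∀ n, Bool × ℕ → Set (Composition n) := fun n i =>
    deviating i.1 (limitShape ((i.2 + 1 : ℝ) * (ε / 2))) (ε / 2) n
  have hbad : Tendsto (fun n : ℕ => ∑ i ∈ I, ((bad n i).ncard : ℝ) / numUnimodal n) atTop
      (𝓝 0) := by
    have := tendsto_finsetSum I fun i _ => tendsto_deviating i.1
      (limitShape_pos (show 0 < (i.2 + 1 : ℝ) * (ε / 2) by positivity)) (half_pos hε)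
    simpa using this
  have hlow := hbad.const_sub 1
  rw [sub_zero] at hlow
  refine tendsto_of_tendsto_of_tendsto_of_le_of_le' hlow tendsto_const_nhds ?_ ?_
  · filter_upwards [eventually_exp_le_numUnimodal one_pos, eventually_ne_atTop 0] with n hs hn
    have hs : 0 < (numUnimodal n : ℝ) := (Real.exp_pos _).trans_le hs
    have hsub : unimodalSeqs n ⊆
        {c ∈ unimodalSeqs n | renormShape c ⊆ curveNhd ε {x | x ≠ 0} limitShape} ∪
          ⋃ i ∈ I, bad n i := by
      intro c hc
      by_cases h : ∃ i ∈ I, c ∈ bad n i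
      · obtain ⟨i, hi, hci⟩ := h
        exact Or.inr (Set.mem_biUnion hi hci)
      · push Not at h
        exact Or.inl ⟨hc, renormShape_subset_curveNhd hc hε hn fun b j hj =>
          h (b, j) (Finset.mem_product.2 ⟨Finset.mem_univ _, Finset.mem_range.2 hj⟩)⟩
    have hcard := (Set.ncard_le_ncard hsub (Set.toFinite _)).trans (Set.ncard_union_le _ _)
    have hcard2 := hcard.trans (Nat.add_le_add_left (Finset.set_ncard_biUnion_le I (bad n)) _)
    have hcard3 : (numUnimodal n : ℝ) ≤
        ({c ∈ unimodalSeqs n | renormShape c ⊆ curveNhd ε {x | x ≠ 0} limitShape}.ncard : ℕ) +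
          ∑ i ∈ I, ((bad n i).ncard : ℝ) := by exact_mod_cast hcard2
    rw [← Finset.sum_div, le_div_iff₀ hs, sub_mul, div_mul_cancel₀ _ hs.ne']
    linarith
  · refine Eventually.of_forall fun n => div_le_one_of_le₀ ?_ (by positivity)
    exact_mod_cast Set.ncard_le_ncard (Set.sep_subset (unimodalSeqs n) _) (Set.toFinite _)

/-- If all parts are at most `t * √n`, then there are no parts of size at least `2 * t * √n`, far
fewer than the typical number `limitShape (2 * t) * √n`. -/
lemma tendsto_peak_le {t : ℝ} (ht : 0 < t) :
    Tendsto (fun n : ℕ =>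
        (({c ∈ unimodalSeqs n | (peak c : ℝ) ≤ t * √(n : ℝ)}.ncard : ℕ) : ℝ)
          / (numUnimodal n : ℝ)) atTop (𝓝 0) := by
  have h2t : 0 < 2 * t := by linarith
  refine squeeze_zero' (Eventually.of_forall fun n => by positivity) ?_
    (tendsto_deviating true h2t (limitShape_pos h2t))
  filter_upwards [eventually_gt_atTop 0] with n hn
  have hr : 0 < √(n : ℝ) := Real.sqrt_pos.2 (by exact_mod_cast hn)
  refine div_le_div_of_nonneg_right (Nat.cast_le.2 (Set.ncard_le_ncard ?_ (Set.toFinite _)))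
    (Nat.cast_nonneg _)
  rintro c ⟨hc, hpk⟩
  have h0 : sideCount c true (2 * t * √n) = 0 := by
    refine List.countP_eq_zero.2 fun a ha => ?_
    rw [decide_eq_true_eq, not_le]
    have hap : (a : ℝ) ≤ peak c := by exact_mod_cast le_peak (mem_blocks_of_mem_sidePart ha)
    nlinarith
  refine ⟨hc, ?_⟩
  rw [h0, Nat.cast_zero, zero_sub, abs_neg]
  exact le_abs_self _

end UnimodalShape

theorem theorem1p2 :
    -- asymptotically all renormalized shapes are within `ε` of the limit shape
    (∀ ε : ℝ, 0 < ε →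
      Tendsto (fun n : ℕ =>
          (({c ∈ unimodalSeqs n | renormShape c ⊆ curveNhd ε {x | x ≠ 0} limitShape}.ncard : ℕ) : ℝ)
            / (numUnimodal n : ℝ))
        atTop (𝓝 1)) ∧
    -- each half of the limit shape is the curve of Vershik, scaled by `1 / √2` in both directions
    (∀ x : ℝ, x ≠ 0 → limitShape x = vershikCurve (√2 * |x|) / √2) ∧
    -- and has area `1 / 2` below it
    (IntegrableOn limitShape (Set.Iio 0) ∧ ∫ x in Set.Iio (0 : ℝ), limitShape x = 1 / 2) ∧
    (IntegrableOn limitShape (Set.Ioi 0) ∧ ∫ x in Set.Ioi (0 : ℝ), limitShape x = 1 / 2) ∧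
    -- peaks of almost all unimodal sequences are larger than any constant multiple of `√n`
    (∀ t : ℝ, 0 < t →
      Tendsto (fun n : ℕ =>
          (({c ∈ unimodalSeqs n | (peak c : ℝ) ≤ t * √(n : ℝ)}.ncard : ℕ) : ℝ)
            / (numUnimodal n : ℝ))
        atTop (𝓝 0)) := by
  exact ⟨fun _ hε => tendsto_renormShape_subset hε, fun x _ => limitShape_eq_vershikCurve x,
    limitShape_integral_Iio, limitShape_integral_Ioi, fun _ ht => tendsto_peak_le ht⟩
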